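/- Let $d\in\mathbb N$, let $q_\Phi$ be an integer with $|q_\Phi|\ge 2$, let $\mathcal A$ be a finite non-empty set, let $\mathfrak p_a\in\mathbb Z^d$ for $a\in\mathcal A$, and consider the equicontractive iterated function system $\Phi=\{\phi_a(x)=\frac{x+\mathfrak p_a}{q_\Phi}\}_{a\in\mathcal A}$ on $\mathbb R^d$ (with no separation assumption). Let $\pi:\mathcal A^{\mathbb N}\to\mathbb R^d$, $\pi((a_n))=\lim_{n\to\infty}(\phi_{a_1}\circ\cdots\circ\phi_{a_n})(0)$, let $X=\pi(\mathcal A^{\mathbb N})$ be the self-similar set of $\Phi$ (the unique non-empty compact set with $X=\bigcup_{a}\phi_a(X)$), and let $\mu$ be the image under $\pi$ of the Bernoulli measure on $\mathcal A^{\mathbb N}$ giving each symbol probability $1/\#\mathcal A$. For $x\in X\cap\mathbb Q^d$ define the intrinsic denominator $q_{int}(x)$ as the infimum of $|q_\Phi^{\,l}(q_\Phi^{\,n-l}-1)|$ over all $n\ge1$, $0\le l\le n-1$ and words $a_1\cdots a_n\in\mathcal A^n$ with $x=\pi(a_1\cdots a_l(a_{l+1}\cdots a_n)^\infty)$. Let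 $\Psi:\{1,2,\dots\}\to[0,\infty)$ be non-increasing, and put $$W^*_\Phi(\Psi)=\{x\in X:\ \|x-y\|<\Psi(q_{int}(y))\text{ for infinitely many } y\in X\cap\mathbb Q^d\}.$$ Then: (1) For every $s\ge0$ such that $\sum_{n=1}^\infty n\cdot(\#\mathcal A)^n\cdot\Psi(|q_\Phi|^n)^s<\infty$ (with $0^0=1$) we have $\mathcal H^s(W^*_\Phi(\Psi))=0$, where $\mathcal H^s$ is $s$-dimensional Hausdorff measure. (2) If the maps $\phi_a$ are not all equal (equivalently, $X$ is not a single point) and $\sum_{n=1}^\infty n\cdot(\#\mathcal A)^n\cdot\Psi(|q_\Phi|^n)^{\frac{\log\#\mathcal A}{\log|q_\Phi|}}=\infty$, then $\mu(W^*_\Phi(\Psi))=1$. -/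

import Mathlib

open MeasureTheory Filter Topology
open scoped NNReal ENNReal

noncomputable section

namespace IntrinsicApprox

variable {d : ℕ} {A : Type*}

/-- The integer vector `v ∈ ℤ^d`, seen as a point of Euclidean space `ℝ^d`. -/
def intVec (v : Fin d → ℤ) : EuclideanSpace ℝ (Fin d) :=
  WithLp.toLp 2 (fun i => (v i : ℝ))

/-- The similarity `φ_a(x) = (x + p_a) / q` of the equicontractive iterated function system. -/
def ifsMap (q : ℤ) (p : A → Fin d → ℤ) (a : A) (x : EuclideanSpace ℝ (Fin d)) :
    EuclideanSpace ℝ (Fin d) :=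
  (q : ℝ)⁻¹ • (x + intVec (p a))

/-- The composition `φ_{a_1} ∘ ⋯ ∘ φ_{a_n}` of the first `n` maps along the sequence `a`
(whose entries `a_1, a_2, …` are written `a 0, a 1, …`). -/
def prefixMap (q : ℤ) (p : A → Fin d → ℤ) (a : ℕ → A) :
    ℕ → EuclideanSpace ℝ (Fin d) → EuclideanSpace ℝ (Fin d)
  | 0 => id
  | n + 1 => prefixMap q p a n ∘ ifsMap q p (a n)

/-- The projection `π : A^ℕ → ℝ^d`, `π(a) = lim_n (φ_{a_1} ∘ ⋯ ∘ φ_{a_n})(0)`.  The limit exists,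
see `tendsto_prefixMap`. -/
def codingMap (q : ℤ) (p : A → Fin d → ℤ) (a : ℕ → A) : EuclideanSpace ℝ (Fin d) :=
  limUnder atTop (fun n => prefixMap q p a n 0)

/-- The self-similar set `X = π(A^ℕ)`.  It is the unique non-empty compact set with
`X = ⋃_a φ_a(X)`, see `selfSimilarSet_characterization`. -/
def selfSimilarSet (q : ℤ) (p : A → Fin d → ℤ) : Set (EuclideanSpace ℝ (Fin d)) :=
  Set.range (codingMap q p)

/-- The Bernoulli measure on `A^ℕ` giving each symbol the same probability `1 / #A`. -/
def bernoulliMeasure (A : Type*) [Fintype A] [Nonempty A] :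
    @Measure (ℕ → A) (@MeasurableSpace.pi ℕ (fun _ => A) (fun _ => ⊤)) :=
  letI : MeasurableSpace A := ⊤
  Measure.infinitePi (fun _ : ℕ => (PMF.uniformOfFintype A).toMeasure)

/-- The self-similar measure `μ` of the system: the image under `π` of the Bernoulli measure.
All contraction ratios are equal to `r = 1/|q|` and `s = log #A / log |q|` is the similarity
dimension, so the natural weights `r^s` are all equal to `1 / #A`. -/
def selfSimilarMeasure [Fintype A] [Nonempty A] (q : ℤ) (p : A → Fin d → ℤ) :
    Measure (EuclideanSpace ℝ (Fin d)) :=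
  letI : MeasurableSpace A := ⊤
  (bernoulliMeasure A).map (codingMap q p)

/-- The eventually periodic sequence `a_1 ⋯ a_l (a_{l+1} ⋯ a_n)^∞`, for a word `a` of length `n`
and `0 ≤ l ≤ n - 1`. -/
def eventuallyPeriodic {n : ℕ} (a : Fin n → A) (l : Fin n) : ℕ → A := fun k =>
  if h : k < l then a ⟨k, h.trans l.isLt⟩
  else a ⟨l + (k - l) % (n - l), by
    have := Nat.mod_lt (k - l) (Nat.sub_pos_of_lt l.isLt)
    omega⟩

/-- The intrinsic denominator of a rational point `x` of the self-similar set: the infimum of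
`|q^l (q^(n-l) - 1)|` over all words `a` of length `n` and `0 ≤ l ≤ n - 1` with
`x = π(a_1 ⋯ a_l (a_{l+1} ⋯ a_n)^∞)`. (The absolute value matters only for negative `q`.) -/
def intrinsicDenom (q : ℤ) (p : A → Fin d → ℤ) (x : EuclideanSpace ℝ (Fin d)) : ℕ :=
  sInf {Q : ℕ | ∃ (n : ℕ) (a : Fin n → A) (l : Fin n),
    x = codingMap q p (eventuallyPeriodic a l) ∧
      Q = (q ^ (l : ℕ) * (q ^ (n - (l : ℕ)) - 1)).natAbs}

/-- The points of `ℚ^d` inside `ℝ^d`. -/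
def IsRationalPoint (x : EuclideanSpace ℝ (Fin d)) : Prop :=
  ∀ i, ∃ r : ℚ, x i = (r : ℝ)

/-- `W*(Ψ)`: the points `x` of the self-similar set `X` such that `‖x - y‖ < Ψ(q_int(y))` for
infinitely many rational points `y` of `X`. -/
def intrinsicWellApprox (q : ℤ) (p : A → Fin d → ℤ) (Ψ : ℕ → ℝ≥0) :
    Set (EuclideanSpace ℝ (Fin d)) :=
  {x | x ∈ selfSimilarSet q p ∧
    {y | y ∈ selfSimilarSet q p ∧ IsRationalPoint y ∧
      ‖x - y‖ < (Ψ (intrinsicDenom q p y) : ℝ)}.Infinite}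

/-! Proofs that the limit, the set and the measure above are the intended objects. -/

theorem prefixMap_apply (q : ℤ) (p : A → Fin d → ℤ) (a : ℕ → A) (n : ℕ)
    (x : EuclideanSpace ℝ (Fin d)) :
    prefixMap q p a n x =
      ∑ k ∈ Finset.range n, ((q : ℝ)⁻¹ ^ (k + 1)) • intVec (p (a k)) + ((q : ℝ)⁻¹ ^ n) • x := by
  induction n generalizing x with
  | zero => simp [prefixMap]
  | succ n ih =>
    simp only [prefixMap, Function.comp, ih, ifsMap, Finset.sum_range_succ, smul_smul, smul_add,
      pow_succ]
    abel

theorem norm_inv_lt_one {q : ℤ} (hq : 2 ≤ |q|) : ‖(q : ℝ)⁻¹‖ < 1 := by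
  have h : (2 : ℝ) ≤ |(q : ℝ)| := by exact_mod_cast hq
  rw [norm_inv, Real.norm_eq_abs]
  exact inv_lt_one_of_one_lt₀ (by linarith)

theorem exists_bound [Finite A] (p : A → Fin d → ℤ) : ∃ C : ℝ, ∀ a, ‖intVec (p a)‖ ≤ C := by
  obtain ⟨C, hC⟩ := (Set.finite_range fun a => ‖intVec (p a)‖).bddAbove
  exact ⟨C, fun a => hC ⟨a, rfl⟩⟩

theorem summable_bound {q : ℤ} (hq : 2 ≤ |q|) (C : ℝ) :
    Summable fun n : ℕ => ‖(q : ℝ)⁻¹‖ ^ (n + 1) * C :=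
  ((summable_nat_add_iff 1).2
    (summable_geometric_of_lt_one (norm_nonneg _) (norm_inv_lt_one hq))).mul_right C

theorem norm_term_le {q : ℤ} {p : A → Fin d → ℤ} {C : ℝ} (hC : ∀ a, ‖intVec (p a)‖ ≤ C)
    (a : ℕ → A) (n : ℕ) :
    ‖((q : ℝ)⁻¹ ^ (n + 1)) • intVec (p (a n))‖ ≤ ‖(q : ℝ)⁻¹‖ ^ (n + 1) * C := by
  rw [norm_smul, norm_pow]
  exact mul_le_mul_of_nonneg_left (hC _) (by positivity)

theorem tendsto_prefixMap_tsum [Finite A] {q : ℤ} (hq : 2 ≤ |q|) (p : A → Fin d → ℤ) (a : ℕ → A)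
    (x : EuclideanSpace ℝ (Fin d)) :
    Tendsto (fun n => prefixMap q p a n x) atTop
      (𝓝 (∑' n, ((q : ℝ)⁻¹ ^ (n + 1)) • intVec (p (a n)))) := by
  obtain ⟨C, hC⟩ := exists_bound p
  have hs : Summable fun n => ((q : ℝ)⁻¹ ^ (n + 1)) • intVec (p (a n)) :=
    Summable.of_norm_bounded (summable_bound hq C) (norm_term_le hC a)
  have h2 : Tendsto (fun n : ℕ => ((q : ℝ)⁻¹ ^ n) • x) atTop (𝓝 0) := by
    simpa using (tendsto_pow_atTop_nhds_zero_of_norm_lt_one (norm_inv_lt_one hq)).smul_const x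
  simpa [prefixMap_apply] using hs.hasSum.tendsto_sum_nat.add h2

/-- The projection as a series, `π(a) = ∑_{n ≥ 1} p_{a_n} / q^n`. -/
theorem codingMap_eq_tsum [Finite A] {q : ℤ} (hq : 2 ≤ |q|) (p : A → Fin d → ℤ) (a : ℕ → A) :
    codingMap q p a = ∑' n, ((q : ℝ)⁻¹ ^ (n + 1)) • intVec (p (a n)) :=
  (tendsto_prefixMap_tsum hq p a 0).limUnder_eq

/-- The limit defining `π(a)` exists, and any starting point `x` may be used in place of `0`. -/
theorem tendsto_prefixMap [Finite A] {q : ℤ} (hq : 2 ≤ |q|) (p : A → Fin d → ℤ) (a : ℕ → A)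
    (x : EuclideanSpace ℝ (Fin d)) :
    Tendsto (fun n => prefixMap q p a n x) atTop (𝓝 (codingMap q p a)) := by
  rw [codingMap_eq_tsum hq]
  exact tendsto_prefixMap_tsum hq p a x

theorem continuous_codingMap [Finite A] [TopologicalSpace A] [DiscreteTopology A] {q : ℤ}
    (hq : 2 ≤ |q|) (p : A → Fin d → ℤ) : Continuous (codingMap q p) := by
  obtain ⟨C, hC⟩ := exists_bound p
  have : codingMap q p = fun a => ∑' n, ((q : ℝ)⁻¹ ^ (n + 1)) • intVec (p (a n)) :=
    funext fun a => codingMap_eq_tsum hq p a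
  rw [this]
  refine continuous_tsum (fun n => ?_) (summable_bound hq C) (fun n a => norm_term_le hC a n)
  have h : Continuous fun b : A => ((q : ℝ)⁻¹ ^ (n + 1)) • intVec (p b) :=
    continuous_of_discreteTopology
  exact h.comp (continuous_apply n)

theorem measurable_codingMap [Finite A] {q : ℤ} (hq : 2 ≤ |q|) (p : A → Fin d → ℤ) :
    @Measurable (ℕ → A) _ (@MeasurableSpace.pi ℕ (fun _ => A) (fun _ => ⊤)) _
      (codingMap q p) := by
  let : MeasurableSpace A := ⊤
  let : TopologicalSpace A := ⊥
  have : DiscreteTopology A := ⟨rfl⟩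
  have : BorelSpace A := ⟨borel_eq_top_of_discrete.symm⟩
  exact (continuous_codingMap hq p).measurable

theorem ifsMap_codingMap [Finite A] {q : ℤ} (hq : 2 ≤ |q|) (p : A → Fin d → ℤ) (a : ℕ → A) :
    codingMap q p a = ifsMap q p (a 0) (codingMap q p fun n => a (n + 1)) := by
  obtain ⟨C, hC⟩ := exists_bound p
  have hs : Summable fun n => ((q : ℝ)⁻¹ ^ (n + 1)) • intVec (p (a n)) :=
    Summable.of_norm_bounded (summable_bound hq C) (norm_term_le hC a)
  have hs' : Summable fun n => ((q : ℝ)⁻¹ ^ (n + 1)) • intVec (p (a (n + 1))) :=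
    Summable.of_norm_bounded (summable_bound hq C) (norm_term_le hC fun n => a (n + 1))
  rw [codingMap_eq_tsum hq, codingMap_eq_tsum hq, hs.tsum_eq_zero_add, ifsMap, smul_add,
    ← hs'.tsum_const_smul]
  simp only [smul_smul, zero_add, pow_one]
  rw [add_comm]
  congr 1
  refine tsum_congr fun n => ?_
  rw [pow_succ' _ (n + 1)]

theorem selfSimilarSet_eq_iUnion [Finite A] {q : ℤ} (hq : 2 ≤ |q|) (p : A → Fin d → ℤ) :
    selfSimilarSet q p = ⋃ a, ifsMap q p a '' selfSimilarSet q p := by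
  ext x
  simp only [Set.mem_iUnion, Set.mem_image, selfSimilarSet, Set.mem_range]
  constructor
  · rintro ⟨a, rfl⟩
    exact ⟨a 0, _, ⟨_, rfl⟩, (ifsMap_codingMap hq p a).symm⟩
  · rintro ⟨b, _, ⟨a, rfl⟩, rfl⟩
    exact ⟨fun n => if n = 0 then b else a (n - 1), by
      simpa using ifsMap_codingMap hq p fun n => if n = 0 then b else a (n - 1)⟩

theorem isCompact_selfSimilarSet [Finite A] {q : ℤ} (hq : 2 ≤ |q|) (p : A → Fin d → ℤ) :
    IsCompact (selfSimilarSet q p) := by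
  let : TopologicalSpace A := ⊥
  have : DiscreteTopology A := ⟨rfl⟩
  exact isCompact_range (continuous_codingMap hq p)

/-- `X` is the only non-empty compact set with `X = ⋃_a φ_a(X)`. -/
theorem selfSimilarSet_characterization [Finite A] [Nonempty A] {q : ℤ} (hq : 2 ≤ |q|)
    (p : A → Fin d → ℤ) (Y : Set (EuclideanSpace ℝ (Fin d))) :
    (Y.Nonempty ∧ IsCompact Y ∧ Y = ⋃ a, ifsMap q p a '' Y) ↔ Y = selfSimilarSet q p := by
  constructor
  · rintro ⟨⟨y, hy⟩, hc, hY⟩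
    apply Set.Subset.antisymm
    · intro x hx
      have key : ∀ z : Y, ∃ (b : A) (w : Y), (z : EuclideanSpace ℝ (Fin d)) = ifsMap q p b w := by
        rintro ⟨z, hz⟩
        rw [hY] at hz
        obtain ⟨b, w, hw, h⟩ := Set.mem_iUnion.1 hz
        exact ⟨b, ⟨w, hw⟩, h.symm⟩
      choose b w hbw using key
      let t : ℕ → Y := fun n => w^[n] ⟨x, hx⟩
      let a : ℕ → A := fun n => b (t n)
      have h1 : ∀ n, prefixMap q p a n (t n) = x := by
        intro n
        induction n with
        | zero => rfl
        | succ n ih =>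
          have : (t (n + 1) : EuclideanSpace ℝ (Fin d)) = w (t n) := by
            simp only [t, Function.iterate_succ_apply']
          rw [prefixMap, Function.comp, this, ← hbw, ih]
      obtain ⟨C, hC⟩ := hc.isBounded.exists_norm_le
      have h2 : Tendsto (fun n : ℕ => ((q : ℝ)⁻¹ ^ n) • (t n : EuclideanSpace ℝ (Fin d)))
          atTop (𝓝 0) := by
        apply squeeze_zero_norm (a := fun n : ℕ => ‖(q : ℝ)⁻¹‖ ^ n * C)
        · intro n
          rw [norm_smul, norm_pow]
          exact mul_le_mul_of_nonneg_left (hC _ (t n).2) (by positivity)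
        · simpa using (tendsto_pow_atTop_nhds_zero_of_lt_one (norm_nonneg _)
            (norm_inv_lt_one hq)).mul_const C
      have h3 := (tendsto_prefixMap hq p a 0).add h2
      have h4 : (fun n => prefixMap q p a n 0 +
          ((q : ℝ)⁻¹ ^ n) • (t n : EuclideanSpace ℝ (Fin d))) = fun _ => x := by
        funext n
        rw [← h1 n]
        simp [prefixMap_apply]
      rw [h4, add_zero] at h3
      exact ⟨a, tendsto_nhds_unique h3 tendsto_const_nhds⟩
    · rintro _ ⟨a, rfl⟩
      have hm : ∀ n, ∀ z ∈ Y, prefixMap q p a n z ∈ Y := by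
        intro n
        induction n with
        | zero => exact fun z hz => hz
        | succ n ih =>
          intro z hz
          refine ih _ ?_
          rw [hY]
          exact Set.mem_iUnion.2 ⟨a n, z, hz, rfl⟩
      exact hc.isClosed.mem_of_tendsto (tendsto_prefixMap hq p a y)
        (Eventually.of_forall fun n => hm n y hy)
  · rintro rfl
    exact ⟨Set.range_nonempty _, isCompact_selfSimilarSet hq p, selfSimilarSet_eq_iUnion hq p⟩

theorem isProbabilityMeasure_selfSimilarMeasure [Fintype A] [Nonempty A] {q : ℤ} (hq : 2 ≤ |q|)
    (p : A → Fin d → ℤ) : IsProbabilityMeasure (selfSimilarMeasure q p) := by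
  let : MeasurableSpace A := ⊤
  have : IsProbabilityMeasure (bernoulliMeasure A) := by
    unfold bernoulliMeasure; infer_instance
  exact Measure.isProbabilityMeasure_map (measurable_codingMap hq p).aemeasurable

end IntrinsicApprox

end

/-! Both parts are Borel–Cantelli arguments in the full shift `A^ℕ`. A rational point `y` of `X` has
an eventually periodic coding (`exists_eventuallyPeriodic`), and a word of length `n` that attains
the intrinsic denominator of `y` makes it comparable with `|q|^n` (`pow_le_natAbs_denom`,
`natAbs_denom_le`).

*Convergence.* There are at most `n (#A)^n` points whose denominator comes from a word of length
`n`, so that the balls of radius `Ψ(|q|^(n-1))` around them give covers whose `s`-dimensional sums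
are bounded by multiples of tails of the convergent series.

*Divergence.* Put `b = #A`. If the block of length `t` at position `n` of a sequence `ω` repeats the
block at a position `l < n`, then `ω` agrees with `ω_0 ⋯ ω_{l-1} (ω_l ⋯ ω_{n-1})^∞` on its first
`n + t` letters, so that `π(ω)` is within `O(|q|^(-(n+t)))` of a rational point of denominator at
most `|q|^(n+1)`. Choosing for each `n` the least `t n` that makes this distance smaller than
`Ψ(|q|^(n+1))`, divergence of the series becomes `∑ n b^(-t n) = ∞`
(`exists_time_of_tsum_eq_top`), and it remains to find infinitely many such recurrences in almost
every `ω` (`ae_infinite_recurrence`). This only concerns the uniform product measure, so that no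
separation of the pieces of `X` is needed.

Indices with `t n > n / 4` do not affect divergence, and for the others it suffices to use
`l < n / 4`. Two such recurrences at `(l, n)` and `(l', n')` are then independent unless both their first blocks and
their second blocks overlap. In that case the letters of either union of blocks are determined by
letters elsewhere, which bounds the probability of the intersection by
`b^(-max(|l - l'|, |n - n'|))` times the sum of the two probabilities
(`real_recurrenceEvent_inter_le`). Hence the variance of the number of recurrences is at most a
constant times its mean, and Chebyshev's inequality (`ae_infinite_of_sum_inter_le`) gives infinitely
many with probability one, without a zero-one law. The approximating points take infinitely many
values because they converge to `π(ω)`, which is almost surely not rational: the image of the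
product measure has no atoms (`uniformProduct_codingMap_eq_zero`).
-/

namespace IntrinsicApprox

/-! ### A Borel–Cantelli lemma from second moments -/

/-- If the number of events that occur has variance at most a constant times its mean, over every
finite subfamily, and the probabilities are not summable, then almost surely infinitely many of the
events occur: by Chebyshev's inequality the probability that at most `K` of them occur is zero. -/
theorem ae_infinite_of_sum_inter_le {Ω ι : Type*} [MeasurableSpace Ω] (μ : Measure Ω)
    [IsProbabilityMeasure μ] (E : ι → Set Ω) (hE : ∀ i, MeasurableSet (E i)) (C : ℝ)
    (h2 : ∀ T : Finset ι, ∑ i ∈ T, ∑ j ∈ T, μ.real (E i ∩ E j) ≤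
      (∑ i ∈ T, μ.real (E i)) ^ 2 + C * ∑ i ∈ T, μ.real (E i))
    (hdiv : ∀ M : ℝ, ∃ T : Finset ι, M ≤ ∑ i ∈ T, μ.real (E i)) :
    ∀ᵐ ω ∂μ, {i | ω ∈ E i}.Infinite := by
  classical
  let X : Finset ι → Ω → ℝ := fun T ω => ∑ i ∈ T, (E i).indicator (fun _ => (1 : ℝ)) ω
  have hX : ∀ T, MemLp (X T) 2 μ := fun T =>
    memLp_finsetSum T fun i _ => memLp_indicator_const 2 (hE i) 1 (Or.inr (measure_ne_top _ _))
  have hXmean : ∀ T, ∫ ω, X T ω ∂μ = ∑ i ∈ T, μ.real (E i) := by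
    intro T
    simp only [X]
    rw [integral_finsetSum]
    · exact Finset.sum_congr rfl fun i _ => integral_indicator_one (hE i)
    · exact fun i _ => (integrable_const 1).indicator (hE i)
  have hXsq : ∀ T, ∫ ω, ((X T) ^ 2) ω ∂μ = ∑ i ∈ T, ∑ j ∈ T, μ.real (E i ∩ E j) := by
    intro T
    have : (X T) ^ 2 = fun ω => ∑ i ∈ T, ∑ j ∈ T,
        (E i ∩ E j).indicator (fun _ => (1 : ℝ)) ω := by
      funext ω
      simp only [Pi.pow_apply, X, sq, Finset.sum_mul_sum]
      refine Finset.sum_congr rfl fun i _ => Finset.sum_congr rfl fun j _ => ?_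
      by_cases hi : ω ∈ E i <;> by_cases hj : ω ∈ E j <;> simp [hi, hj]
    rw [this, integral_finsetSum]
    · refine Finset.sum_congr rfl fun i _ => ?_
      rw [integral_finsetSum]
      · exact Finset.sum_congr rfl fun j _ => integral_indicator_one ((hE i).inter (hE j))
      · exact fun j _ => (integrable_const 1).indicator ((hE i).inter (hE j))
    · exact fun i _ => integrable_finsetSum _ fun j _ =>
        (integrable_const 1).indicator ((hE i).inter (hE j))
  have hvar : ∀ T, ProbabilityTheory.variance (X T) μ ≤ C * ∑ i ∈ T, μ.real (E i) := by
    intro T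
    rw [ProbabilityTheory.variance_eq_sub (hX T), hXsq, hXmean]
    linarith [h2 T]
  -- Chebyshev's inequality at distance half the mean `M ≥ 2 K`, with `M → ∞`.
  have hK : ∀ K : ℕ, μ {ω | ∀ T, X T ω ≤ K} = 0 := by
    intro K
    have key : ∀ n : ℕ, μ {ω | ∀ T, X T ω ≤ K} ≤ ENNReal.ofReal (4 * |C| / (n + 1)) := by
      intro n
      obtain ⟨T, hT⟩ := hdiv (n + 1 + 2 * K)
      set M := ∑ i ∈ T, μ.real (E i) with hM
      have hn : (0 : ℝ) < n + 1 := by positivity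
      have hKnn : (0 : ℝ) ≤ K := by positivity
      have hMpos : 0 < M := by linarith
      calc μ {ω | ∀ T, X T ω ≤ K} ≤ μ {ω | M / 2 ≤ |X T ω - ∫ ω', X T ω' ∂μ|} := by
            refine measure_mono fun ω hω => ?_
            have := hω T
            rw [Set.mem_ofPred_eq, hXmean, ← hM, abs_sub_comm]
            exact le_trans (by linarith) (le_abs_self _)
        _ ≤ ENNReal.ofReal (ProbabilityTheory.variance (X T) μ / (M / 2) ^ 2) :=
            ProbabilityTheory.meas_ge_le_variance_div_sq (hX T) (by linarith)
        _ ≤ ENNReal.ofReal (4 * |C| / (n + 1)) := by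
            refine ENNReal.ofReal_le_ofReal ?_
            rw [div_le_div_iff₀ (by positivity) hn]
            have h1 : ProbabilityTheory.variance (X T) μ ≤ |C| * M :=
              (hvar T).trans (mul_le_mul_of_nonneg_right (le_abs_self C) hMpos.le)
            calc ProbabilityTheory.variance (X T) μ * (n + 1) ≤ |C| * M * M :=
                  mul_le_mul h1 (by linarith) hn.le (by positivity)
              _ = 4 * |C| * (M / 2) ^ 2 := by ring
    have hlim : Tendsto (fun n : ℕ => ENNReal.ofReal (4 * |C| / ((n : ℝ) + 1))) atTop (𝓝 0) := by
      have : Tendsto (fun n : ℕ => 4 * |C| / ((n : ℝ) + 1)) atTop (𝓝 0) :=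
        tendsto_const_nhds.div_atTop (tendsto_natCast_atTop_atTop.atTop_add tendsto_const_nhds)
      simpa using ENNReal.tendsto_ofReal this
    exact le_antisymm (ge_of_tendsto' hlim key) (zero_le)
  have hall : ∀ᵐ ω ∂μ, ∀ K : ℕ, ¬ ∀ T, X T ω ≤ K :=
    ae_all_iff.2 fun K => measure_eq_zero_iff_ae_notMem.1 (hK K)
  filter_upwards [hall] with ω hω hfin
  refine hω hfin.toFinset.card fun T => ?_
  have h1 : X T ω = ((T.filter fun i => ω ∈ E i).card : ℝ) := by
    simp [X, Set.indicator_apply]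
  rw [h1]
  exact_mod_cast Finset.card_le_card fun i hi => by simpa using (Finset.mem_filter.1 hi).2

/-! ### The uniform product measure -/

section Symbolic

variable {A : Type*} [Fintype A] [Nonempty A] [MeasurableSpace A] [DiscreteMeasurableSpace A]

variable (A) in
/-- The product over `ℕ` of the uniform measure on `A`, for an arbitrary `σ`-algebra on `A`; with
the discrete one it is `bernoulliMeasure A`. -/
noncomputable abbrev uniformProduct : Measure (ℕ → A) :=
  Measure.infinitePi fun _ : ℕ => (PMF.uniformOfFintype A).toMeasure



/-- Each word on a finite set of positions has the same probability. -/
theorem uniformProduct_cylinder (S : Finset ℕ) (g : ℕ → A) :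
    uniformProduct A {ω | ∀ i ∈ S, ω i = g i} = (Fintype.card A : ℝ≥0∞)⁻¹ ^ S.card := by
  have h : {ω : ℕ → A | ∀ i ∈ S, ω i = g i} = Set.pi S fun i => {g i} := by
    ext ω
    simp [Set.mem_pi]
  rw [h, Measure.infinitePi_pi _ fun i _ => measurableSet_singleton _]
  rw [Finset.prod_congr rfl fun i _ => PMF.toMeasure_apply_singleton _ _
    (measurableSet_singleton (g i))]
  simp

/-- If `F` depends only on the coordinates in `S`, and `R` is disjoint from `S`, then the event
that each coordinate `r ∈ R` repeats the coordinate `f r ∈ S` is independent of `F`, and has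
probability `(#A)^(-#R)`: this holds after conditioning on the word read on `S`. -/
theorem uniformProduct_inter_repeat {S R : Finset ℕ} (hSR : Disjoint S R) {f : ℕ → ℕ}
    (hf : ∀ r ∈ R, f r ∈ S) {F : Set (ℕ → A)} (hFm : MeasurableSet F)
    (hF : ∀ ω ω' : ℕ → A, (∀ i ∈ S, ω i = ω' i) → ω ∈ F → ω' ∈ F) :
    uniformProduct A (F ∩ {ω | ∀ r ∈ R, ω r = ω (f r)}) =
      uniformProduct A F * (Fintype.card A : ℝ≥0∞)⁻¹ ^ R.card := by
  classical
  let ρ : (ℕ → A) → (S → A) := S.restrict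
  have hres : Measurable ρ := Finset.measurable_restrict S
  have decomp : ∀ G : Set (ℕ → A), MeasurableSet G → uniformProduct A G =
      ∑ g : S → A, uniformProduct A (ρ ⁻¹' {g} ∩ G) := by
    intro G hG
    have h := sum_measure_preimage_singleton (μ := (uniformProduct A).restrict G) Finset.univ
      (f := ρ) fun g _ => hres (measurableSet_singleton g)
    rw [Finset.coe_univ, Set.preimage_univ, Measure.restrict_apply_univ] at h
    rw [← h]
    exact Finset.sum_congr rfl fun g _ =>
      Measure.restrict_apply (hres (measurableSet_singleton g))
  have hrep : MeasurableSet {ω : ℕ → A | ∀ r ∈ R, ω r = ω (f r)} := by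
    have : {ω : ℕ → A | ∀ r ∈ R, ω r = ω (f r)} = ⋂ r ∈ R, {ω | ω r = ω (f r)} := by
      ext ω
      simp
    rw [this]
    exact R.measurableSet_biInter fun r _ =>
      measurableSet_eq_fun (measurable_pi_apply r) (measurable_pi_apply (f r))
  rw [decomp _ (hFm.inter hrep), decomp F hFm, Finset.sum_mul]
  refine Finset.sum_congr rfl fun g _ => ?_
  let a₀ : A := Classical.arbitrary A
  -- The word `g` on `S`, continued by `g ∘ f` on `R`.
  let g₁ : ℕ → A := fun i => if h : i ∈ S then g ⟨i, h⟩ else a₀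
  let g₂ : ℕ → A := fun i => if i ∈ S then g₁ i else g₁ (f i)
  have hmem : ∀ ω : ℕ → A, ω ∈ ρ ⁻¹' {g} ↔ ∀ i ∈ S, ω i = g₁ i := by
    intro ω
    simp only [Set.mem_preimage, Set.mem_singleton_iff, funext_iff, ρ, Finset.restrict,
      Subtype.forall]
    refine forall₂_congr fun i hi => ?_
    simp [g₁, hi]
  by_cases hg : g₁ ∈ F
  · have e1 : ρ ⁻¹' {g} ∩ F = {ω : ℕ → A | ∀ i ∈ S, ω i = g₁ i} := by
      ext ω
      rw [Set.mem_inter_iff, hmem]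
      exact ⟨fun h => h.1, fun h => ⟨h, hF g₁ ω (fun i hi => (h i hi).symm) hg⟩⟩
    have e2 : ρ ⁻¹' {g} ∩ (F ∩ {ω : ℕ → A | ∀ r ∈ R, ω r = ω (f r)}) =
        {ω : ℕ → A | ∀ i ∈ S ∪ R, ω i = g₂ i} := by
      ext ω
      rw [← Set.inter_assoc, e1]
      simp only [Set.mem_inter_iff, Set.mem_ofPred_eq, Finset.mem_union, or_imp, forall_and]
      refine and_congr (forall₂_congr fun i hi => by simp [g₂, hi]) Iff.rfl |>.trans
        (and_congr_right fun h => forall₂_congr fun r hr => ?_)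
      have hrS : r ∉ S := fun h' => Finset.disjoint_left.1 hSR h' hr
      have h3 := h (f r) (hf r hr)
      simp only [g₂, hf r hr, if_true] at h3
      simp [g₂, hrS, h3]
    rw [e1, e2, uniformProduct_cylinder, uniformProduct_cylinder,
      Finset.card_union_of_disjoint hSR, pow_add]
  · have e : ρ ⁻¹' {g} ∩ F = ∅ := by
      ext ω
      simp only [Set.mem_inter_iff, hmem, Set.mem_empty_iff_false, iff_false, not_and]
      exact fun h h' => hg (hF ω g₁ h h')
    rw [← Set.inter_assoc, e]
    simp

/-- Applying a permutation to one coordinate preserves the uniform product measure. -/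
theorem measurePreserving_permute (k : ℕ) (τ : Equiv.Perm A) :
    MeasurePreserving (fun (ω : ℕ → A) i => if i = k then τ (ω i) else ω i)
      (uniformProduct A) (uniformProduct A) := by
  have huni : ∀ σ : Equiv.Perm A, ((PMF.uniformOfFintype A).toMeasure).map σ =
      (PMF.uniformOfFintype A).toMeasure := by
    intro σ
    refine Measure.ext_of_singleton fun a => ?_
    rw [Measure.map_apply .of_discrete (measurableSet_singleton a)]
    have : σ ⁻¹' {a} = {σ.symm a} := by
      ext x
      simp [Equiv.eq_symm_apply]
    rw [this, PMF.toMeasure_apply_singleton _ _ (measurableSet_singleton _),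
      PMF.toMeasure_apply_singleton _ _ (measurableSet_singleton _)]
    simp
  let f : ℕ → A → A := fun i => if i = k then τ else Equiv.refl A
  have hfm : ∀ i, Measurable (f i) := fun i => .of_discrete
  have h := Measure.infinitePi_map_pi (fun _ : ℕ => (PMF.uniformOfFintype A).toMeasure) hfm
  have hfun : (fun (ω : ℕ → A) i => if i = k then τ (ω i) else ω i) =
      fun (ω : ℕ → A) i => f i (ω i) := by
    funext ω i
    by_cases hi : i = k <;> simp [f, hi]
  rw [hfun]
  refine ⟨measurable_pi_lambda _ fun i => (hfm i).comp (measurable_pi_apply i), ?_⟩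
  rw [h]
  congr 1
  funext i
  by_cases hi : i = k
  · simp only [f, hi, if_true]; exact huni τ
  · simp only [f, hi, if_false]; exact huni (Equiv.refl A)

end Symbolic

/-! ### Recurrence in the full shift -/

section Recurrence

variable {A : Type*}

variable (A) in
/-- The sequences in which the block of length `t` at position `l` reappears at position `n`. -/
def recurrenceEvent (l n t : ℕ) : Set (ℕ → A) := {ω | ∀ i < t, ω (l + i) = ω (n + i)}

theorem mem_recurrenceEvent_congr {l n t : ℕ} {ω ω' : ℕ → A}
    (h1 : ∀ i ∈ Finset.Ico l (l + t), ω i = ω' i) (h2 : ∀ i ∈ Finset.Ico n (n + t), ω i = ω' i)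
    (h : ω ∈ recurrenceEvent A l n t) : ω' ∈ recurrenceEvent A l n t := by
  intro i hi
  rw [← h1 (l + i) (by simpa using hi), ← h2 (n + i) (by simpa using hi)]
  exact h i hi

/-- A recurrence read at its second block: each letter repeats the one `n - l` places before. -/
theorem recurrenceEvent_eq_right {l n t : ℕ} (hln : l ≤ n) : recurrenceEvent A l n t =
    {ω | ∀ r ∈ Finset.Ico n (n + t), ω r = ω (r - (n - l))} := by
  ext ω
  constructor
  · intro h r hr
    rw [Finset.mem_Ico] at hr
    have := h (r - n) (by omega)
    rw [show l + (r - n) = r - (n - l) by omega, show n + (r - n) = r by omega] at this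
    exact this.symm
  · intro h i hi
    have := h (n + i) (by simpa using hi)
    rw [show n + i - (n - l) = l + i by omega] at this
    exact this.symm

/-- A recurrence read at its first block: each letter repeats the one `n - l` places after. -/
theorem recurrenceEvent_eq_left {l n t : ℕ} (hln : l ≤ n) : recurrenceEvent A l n t =
    {ω | ∀ r ∈ Finset.Ico l (l + t), ω r = ω (r + (n - l))} := by
  ext ω
  constructor
  · intro h r hr
    rw [Finset.mem_Ico] at hr
    have := h (r - l) (by omega)
    rwa [show l + (r - l) = r by omega, show n + (r - l) = r + (n - l) by omega] at this
  · intro h i hi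
    have := h (l + i) (by simpa using hi)
    rwa [show l + i + (n - l) = n + i by omega] at this

variable [Fintype A] [Nonempty A] [MeasurableSpace A] [DiscreteMeasurableSpace A]

omit [Nonempty A] in
theorem measurableSet_recurrenceEvent (l n t : ℕ) : MeasurableSet (recurrenceEvent A l n t) := by
  have : recurrenceEvent A l n t =
      ⋂ i ∈ Finset.range t, {ω : ℕ → A | ω (l + i) = ω (n + i)} := by
    ext ω
    simp [recurrenceEvent]
  rw [this]
  exact Finset.measurableSet_biInter _ fun i _ =>
    measurableSet_eq_fun (measurable_pi_apply _) (measurable_pi_apply _)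

theorem real_uniformProduct_inter_repeat {S R : Finset ℕ} (hSR : Disjoint S R) {f : ℕ → ℕ}
    (hf : ∀ r ∈ R, f r ∈ S) {F : Set (ℕ → A)} (hFm : MeasurableSet F)
    (hF : ∀ ω ω' : ℕ → A, (∀ i ∈ S, ω i = ω' i) → ω ∈ F → ω' ∈ F) :
    (uniformProduct A).real (F ∩ {ω | ∀ r ∈ R, ω r = ω (f r)}) =
      (uniformProduct A).real F * (Fintype.card A : ℝ)⁻¹ ^ R.card := by
  simp [measureReal_def, uniformProduct_inter_repeat hSR hf hFm hF]

theorem real_uniformProduct_repeat {S R : Finset ℕ} (hSR : Disjoint S R) {f : ℕ → ℕ}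
    (hf : ∀ r ∈ R, f r ∈ S) :
    (uniformProduct A).real {ω | ∀ r ∈ R, ω r = ω (f r)} = (Fintype.card A : ℝ)⁻¹ ^ R.card := by
  simpa using real_uniformProduct_inter_repeat hSR hf (F := (Set.univ : Set (ℕ → A))) .univ
    fun _ _ _ _ => trivial

theorem real_recurrenceEvent {l n t : ℕ} (h : l + t ≤ n) :
    (uniformProduct A).real (recurrenceEvent A l n t) = (Fintype.card A : ℝ)⁻¹ ^ t := by
  rw [recurrenceEvent_eq_right (by omega), real_uniformProduct_repeat (S := Finset.range n)]
  · simp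
  · rw [Finset.disjoint_left]
    intro i hi
    simp only [Finset.mem_range, Finset.mem_Ico] at *
    omega
  · intro r hr
    simp only [Finset.mem_range, Finset.mem_Ico] at *
    omega

/-- Two recurrences whose first blocks start in the first quarter and which are short are
independent unless both the first blocks and the second blocks overlap. -/
theorem real_recurrenceEvent_inter_of_disjoint {l n t l' n' t' : ℕ} (hl : 4 * l < n)
    (ht : 4 * t ≤ n) (hl' : 4 * l' < n') (ht' : 4 * t' ≤ n') (hn : n ≤ n')
    (hd : n + t ≤ n' ∨ l + t ≤ l' ∨ l' + t' ≤ l) :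
    (uniformProduct A).real (recurrenceEvent A l n t ∩ recurrenceEvent A l' n' t') =
      (Fintype.card A : ℝ)⁻¹ ^ t * (Fintype.card A : ℝ)⁻¹ ^ t' := by
  rw [← real_recurrenceEvent (A := A) (show l + t ≤ n by omega)]
  by_cases h1 : n + t ≤ n'
  · rw [recurrenceEvent_eq_right (show l' ≤ n' by omega),
      real_uniformProduct_inter_repeat (S := Finset.range n')]
    · simp
    · rw [Finset.disjoint_left]
      intro i hi
      simp only [Finset.mem_range, Finset.mem_Ico] at *
      omega
    · intro r hr
      simp only [Finset.mem_range, Finset.mem_Ico] at *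
      omega
    · exact measurableSet_recurrenceEvent _ _ _
    · intro ω ω' h
      refine mem_recurrenceEvent_congr (fun i hi => h i ?_) (fun i hi => h i ?_) <;>
      · simp only [Finset.mem_range, Finset.mem_Ico] at *
        omega
  · -- The second blocks overlap, so that all first blocks precede all second blocks; the letters
    -- of the block at `l'` are then the ones that are determined by the others.
    rw [recurrenceEvent_eq_left (show l' ≤ n' by omega), real_uniformProduct_inter_repeat
      (S := Finset.range (n + t + n' + t') \ Finset.Ico l' (l' + t'))]
    · simp
    · exact Finset.sdiff_disjoint
    · intro r hr
      simp only [Finset.mem_range, Finset.mem_Ico, Finset.mem_sdiff] at *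
      omega
    · exact measurableSet_recurrenceEvent _ _ _
    · intro ω ω' h
      refine mem_recurrenceEvent_congr (fun i hi => h i ?_) (fun i hi => h i ?_) <;>
      · simp only [Finset.mem_range, Finset.mem_Ico, Finset.mem_sdiff] at *
        omega

/-- When the second blocks overlap, their union is an interval of letters that are all determined
by the letters before it. -/
theorem real_recurrenceEvent_inter_le_right {l n t l' n' t' : ℕ} (hl : 4 * l < n)
    (ht : 4 * t ≤ n) (hl' : 4 * l' < n') (ht' : 4 * t' ≤ n') (hn : n ≤ n') (h1 : n' < n + t) :
    (uniformProduct A).real (recurrenceEvent A l n t ∩ recurrenceEvent A l' n' t') ≤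
      (Fintype.card A : ℝ)⁻¹ ^ (n' - n + t') := by
  have key := real_uniformProduct_repeat (A := A) (S := Finset.range n)
    (R := Finset.Ico n (n' + t')) (f := fun r => if r < n + t then r - (n - l) else r - (n' - l'))
    (by
      rw [Finset.disjoint_left]
      intro i hi
      simp only [Finset.mem_range, Finset.mem_Ico] at *
      omega)
    (by
      intro r hr
      simp only [Finset.mem_range, Finset.mem_Ico] at *
      split_ifs <;> omega)
  rw [Nat.card_Ico, show n' + t' - n = n' - n + t' by omega] at key
  rw [← key]
  refine measureReal_mono ?_
  rw [recurrenceEvent_eq_right (show l ≤ n by omega),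
    recurrenceEvent_eq_right (show l' ≤ n' by omega)]
  rintro ω ⟨h, h'⟩ r hr
  rw [Finset.mem_Ico] at hr
  split_ifs with hr1
  · exact h r (by rw [Finset.mem_Ico]; omega)
  · exact h' r (by rw [Finset.mem_Ico]; omega)

/-- When the first blocks overlap, their union is an interval of letters that are all determined
by letters of the second blocks. -/
theorem real_recurrenceEvent_inter_le_left {l n t l' n' t' : ℕ} (hll : l ≤ l') (h1 : l' ≤ l + t)
    (ha : l' + t' ≤ n) (hb : l' + t' ≤ n') :
    (uniformProduct A).real (recurrenceEvent A l n t ∩ recurrenceEvent A l' n' t') ≤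
      (Fintype.card A : ℝ)⁻¹ ^ (l' - l + t') := by
  have key := real_uniformProduct_repeat (A := A)
    (S := Finset.Ico (l' + t') (l' + t' + n + n' + t))
    (R := Finset.Ico l (l' + t')) (f := fun r => if r < l + t then r + (n - l) else r + (n' - l'))
    (by
      rw [Finset.disjoint_left]
      intro i hi
      simp only [Finset.mem_Ico] at *
      omega)
    (by
      intro r hr
      simp only [Finset.mem_Ico] at *
      split_ifs <;> omega)
  rw [Nat.card_Ico, show l' + t' - l = l' - l + t' by omega] at key
  rw [← key]
  refine measureReal_mono ?_
  rw [recurrenceEvent_eq_left (show l ≤ n by omega),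
    recurrenceEvent_eq_left (show l' ≤ n' by omega)]
  rintro ω ⟨h, h'⟩ r hr
  rw [Finset.mem_Ico] at hr
  split_ifs with hr1
  · exact h r (by rw [Finset.mem_Ico]; omega)
  · exact h' r (by rw [Finset.mem_Ico]; omega)

/-- Short recurrences are pairwise independent up to an error that decays exponentially in the
distance between their positions. -/
theorem real_recurrenceEvent_inter_le (hA : 2 ≤ Fintype.card A) {l n t l' n' t' : ℕ}
    (hl : 4 * l < n) (ht : 4 * t ≤ n) (hl' : 4 * l' < n') (ht' : 4 * t' ≤ n') :
    (uniformProduct A).real (recurrenceEvent A l n t ∩ recurrenceEvent A l' n' t') ≤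
      (Fintype.card A : ℝ)⁻¹ ^ t * (Fintype.card A : ℝ)⁻¹ ^ t' +
        (3 / 4 : ℝ) ^ Nat.dist l l' * (3 / 4 : ℝ) ^ Nat.dist n n' *
          ((Fintype.card A : ℝ)⁻¹ ^ t + (Fintype.card A : ℝ)⁻¹ ^ t') := by
  wlog hn : n ≤ n' generalizing l n t l' n' t'
  · have := this hl' ht' hl ht (by omega)
    rw [Set.inter_comm, Nat.dist_comm l l', Nat.dist_comm n n', mul_comm (_ ^ t) (_ ^ t'),
      add_comm (_ ^ t) (_ ^ t')]
    exact this
  set β : ℝ := (Fintype.card A : ℝ)⁻¹ with hβ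
  have hβ0 : 0 ≤ β := by positivity
  -- As `1 / 2 ≤ (3 / 4) ^ 2`, a factor `β ^ max u v` is at most `(3 / 4) ^ (u + v)`.
  have hβ2 : β ≤ (3 / 4 : ℝ) ^ 2 := by
    have h2 : (2 : ℝ) ≤ Fintype.card A := by exact_mod_cast hA
    calc β ≤ 2⁻¹ := inv_anti₀ two_pos h2
      _ ≤ _ := by norm_num
  have hβ1 : β ≤ 1 := hβ2.trans (by norm_num)
  by_cases hd : n + t ≤ n' ∨ l + t ≤ l' ∨ l' + t' ≤ l
  · rw [real_recurrenceEvent_inter_of_disjoint hl ht hl' ht' hn hd]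
    exact le_add_of_nonneg_right (by positivity)
  push Not at hd
  obtain ⟨h1, h2, h3⟩ := hd
  have bound : ∀ m, (uniformProduct A).real
      (recurrenceEvent A l n t ∩ recurrenceEvent A l' n' t') ≤ β ^ m * (β ^ t + β ^ t') →
      Nat.dist l l' + Nat.dist n n' ≤ 2 * m →
      (uniformProduct A).real (recurrenceEvent A l n t ∩ recurrenceEvent A l' n' t') ≤
      β ^ t * β ^ t' + (3 / 4 : ℝ) ^ Nat.dist l l' * (3 / 4 : ℝ) ^ Nat.dist n n' *
        (β ^ t + β ^ t') := by
    intro m hm hdist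
    refine hm.trans (le_trans ?_ (le_add_of_nonneg_left (by positivity)))
    refine mul_le_mul_of_nonneg_right ?_ (by positivity)
    calc β ^ m ≤ ((3 / 4 : ℝ) ^ 2) ^ m := pow_le_pow_left₀ hβ0 hβ2 m
      _ = (3 / 4 : ℝ) ^ (2 * m) := (pow_mul _ _ _).symm
      _ ≤ (3 / 4 : ℝ) ^ (Nat.dist l l' + Nat.dist n n') :=
        pow_le_pow_of_le_one (by norm_num) (by norm_num) hdist
      _ = _ := pow_add _ _ _
  have ht0 : 0 ≤ β ^ t := by positivity
  have ht0' : 0 ≤ β ^ t' := by positivity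
  -- The larger of the two displacements decides which blocks are used.
  rcases le_total (Nat.dist l l') (n' - n) with hc | hc
  · refine bound (n' - n) ?_ (by unfold Nat.dist at *; omega)
    refine (real_recurrenceEvent_inter_le_right hl ht hl' ht' hn h1).trans ?_
    rw [← hβ, pow_add]
    exact mul_le_mul_of_nonneg_left (by linarith) (by positivity)
  · refine bound (Nat.dist l l') ?_ (by unfold Nat.dist at *; omega)
    rcases le_total l l' with hll | hll
    · refine (real_recurrenceEvent_inter_le_left hll h2.le (by omega) (by omega)).trans ?_
      rw [← hβ, pow_add, Nat.dist_eq_sub_of_le hll]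
      exact mul_le_mul_of_nonneg_left (by linarith) (by positivity)
    · rw [Set.inter_comm]
      refine (real_recurrenceEvent_inter_le_left hll h3.le (by omega) (by omega)).trans ?_
      rw [← hβ, pow_add, Nat.dist_eq_sub_of_le_right hll]
      exact mul_le_mul_of_nonneg_left (by linarith) (by positivity)

end Recurrence

theorem sum_pow_dist_le (U : Finset ℕ) (c : ℕ) :
    ∑ m ∈ U, (3 / 4 : ℝ) ^ Nat.dist c m ≤ 8 := by
  have hs : Summable fun k : ℕ => (3 / 4 : ℝ) ^ k :=
    summable_geometric_of_lt_one (by norm_num) (by norm_num)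
  have ht : ∑' k : ℕ, (3 / 4 : ℝ) ^ k = 4 := by
    rw [tsum_geometric_of_lt_one (by norm_num) (by norm_num)]
    norm_num
  have hinj : ∀ V : Finset ℕ, Set.InjOn (Nat.dist c) V →
      ∑ m ∈ V, (3 / 4 : ℝ) ^ Nat.dist c m ≤ 4 := by
    intro V hV
    rw [← Finset.sum_image (f := fun k => (3 / 4 : ℝ) ^ k) hV]
    exact (hs.sum_le_tsum _ fun k _ => by positivity).trans_eq ht
  rw [← Finset.sum_filter_add_sum_filter_not U fun m => m < c]
  have h1 := hinj (U.filter fun m => m < c) (by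
    intro x hx y hy hxy
    simp only [Finset.coe_filter, Set.mem_ofPred_eq, Nat.dist] at hx hy hxy
    omega)
  have h2 := hinj (U.filter fun m => ¬ m < c) (by
    intro x hx y hy hxy
    simp only [Finset.coe_filter, Set.mem_ofPred_eq, Nat.dist] at hx hy hxy
    omega)
  linarith

theorem sum_pow_dist_mul_pow_dist_le (T : Finset (ℕ × ℕ)) (e : ℕ × ℕ) :
    ∑ x ∈ T, (3 / 4 : ℝ) ^ Nat.dist e.1 x.1 * (3 / 4 : ℝ) ^ Nat.dist e.2 x.2 ≤ 64 := by
  calc ∑ x ∈ T, (3 / 4 : ℝ) ^ Nat.dist e.1 x.1 * (3 / 4 : ℝ) ^ Nat.dist e.2 x.2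
      ≤ ∑ x ∈ T.image Prod.fst ×ˢ T.image Prod.snd,
          (3 / 4 : ℝ) ^ Nat.dist e.1 x.1 * (3 / 4 : ℝ) ^ Nat.dist e.2 x.2 :=
        Finset.sum_le_sum_of_subset_of_nonneg Finset.subset_product fun _ _ _ => by positivity
    _ = (∑ m ∈ T.image Prod.fst, (3 / 4 : ℝ) ^ Nat.dist e.1 m) *
          ∑ m ∈ T.image Prod.snd, (3 / 4 : ℝ) ^ Nat.dist e.2 m := by
        rw [Finset.sum_product, Finset.sum_mul_sum]
    _ ≤ 8 * 8 := mul_le_mul (sum_pow_dist_le _ _) (sum_pow_dist_le _ _)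
        (Finset.sum_nonneg fun _ _ => by positivity) (by norm_num)
    _ = 64 := by norm_num

section

variable {A : Type*} [Fintype A] [Nonempty A] [MeasurableSpace A] [DiscreteMeasurableSpace A]

/-- If `∑ n (#A)^(-t n)`, the expected number of recurrences over `n ∈ G`, is infinite, then almost
every sequence has, for infinitely many `n ∈ G`, its block of length `t n` at position `n` already
occurring at an earlier position. -/
theorem ae_infinite_recurrence (hA : 2 ≤ Fintype.card A) (t : ℕ → ℕ) (G : Set ℕ)
    (hdiv : ¬ Summable (G.indicator fun n => (n : ℝ) * (Fintype.card A : ℝ)⁻¹ ^ t n)) :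
    ∀ᵐ ω ∂uniformProduct A,
      {n | n ∈ G ∧ ∃ l < n, ω ∈ recurrenceEvent A l n (t n)}.Infinite := by
  classical
  set β : ℝ := (Fintype.card A : ℝ)⁻¹ with hβ
  have hβ0 : 0 ≤ β := by positivity
  -- As `1 / 2 ≤ (9 / 10) ^ 4`, `4 * t n > n` implies `β ^ t n ≤ (9 / 10) ^ n`.
  have hβ2 : β ≤ (9 / 10 : ℝ) ^ 4 := by
    have h2 : (2 : ℝ) ≤ Fintype.card A := by exact_mod_cast hA
    calc β ≤ 2⁻¹ := inv_anti₀ two_pos h2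
      _ ≤ _ := by norm_num
  let H : Set ℕ := {n | n ∈ G ∧ 4 * t n ≤ n}
  -- The indices with `t n > n / 4` contribute a convergent series.
  have hdivH : ¬ Summable (H.indicator fun n => (n : ℝ) * β ^ t n) := by
    intro hH
    refine hdiv ?_
    have hgeo : Summable fun n : ℕ => (n : ℝ) * (9 / 10 : ℝ) ^ n := by
      simpa using summable_pow_mul_geometric_of_norm_lt_one 1
        (show ‖(9 / 10 : ℝ)‖ < 1 by norm_num)
    refine Summable.of_nonneg_of_le (fun n => Set.indicator_nonneg (fun _ _ => by positivity) n)
      (fun n => ?_) (hH.add hgeo)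
    by_cases hn : n ∈ G
    · by_cases hn4 : 4 * t n ≤ n
      · have : n ∈ H := ⟨hn, hn4⟩
        rw [Set.indicator_of_mem hn, Set.indicator_of_mem this]
        exact le_add_of_nonneg_right (by positivity)
      · have : n ∉ H := fun h => hn4 h.2
        rw [Set.indicator_of_mem hn, Set.indicator_of_notMem this, zero_add]
        refine mul_le_mul_of_nonneg_left ?_ (by positivity)
        calc β ^ t n ≤ ((9 / 10 : ℝ) ^ 4) ^ t n := pow_le_pow_left₀ hβ0 hβ2 _
          _ = (9 / 10 : ℝ) ^ (4 * t n) := (pow_mul _ _ _).symm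
          _ ≤ _ := pow_le_pow_of_le_one (by norm_num) (by norm_num) (by omega)
    · rw [Set.indicator_of_notMem hn]
      exact add_nonneg (Set.indicator_nonneg (fun _ _ => by positivity) n) (by positivity)
  let cond : ℕ × ℕ → Prop := fun e => 4 * e.1 < e.2 ∧ e.2 ∈ H
  let E : {e // cond e} → Set (ℕ → A) := fun e => recurrenceEvent A e.1.1 e.1.2 (t e.1.2)
  have hE : ∀ e, (uniformProduct A).real (E e) = β ^ t e.1.2 := by
    rintro ⟨⟨l, n⟩, h1, h2, h3⟩
    dsimp only at h1 h2 h3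
    exact real_recurrenceEvent (by dsimp only; omega)
  have hinf := ae_infinite_of_sum_inter_le (uniformProduct A) E
    (fun e => measurableSet_recurrenceEvent _ _ _) 128 ?_ ?_
  · filter_upwards [hinf] with ω hω hfin
    refine hω ?_
    obtain ⟨N, hN⟩ := hfin.bddAbove
    refine Set.Finite.of_finite_image (f := Subtype.val) (Set.Finite.subset
      ((Set.finite_Iic N).prod (Set.finite_Iic N)) ?_) Subtype.val_injective.injOn
    rintro _ ⟨⟨⟨l, n⟩, h1, h2, h3⟩, h4, rfl⟩
    dsimp only at h1 h2 h3
    have hn : n ≤ N := hN ⟨h2, l, by omega, h4⟩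
    exact ⟨Set.mem_Iic.2 (by dsimp only; omega), hn⟩
  · -- Each weight is summed over both orders of the pair, whence `128 = 2 * 64`.
    intro T
    let w : {e // cond e} → {e // cond e} → ℝ := fun e x =>
      (3 / 4 : ℝ) ^ Nat.dist e.1.1 x.1.1 * (3 / 4 : ℝ) ^ Nat.dist e.1.2 x.1.2
    have hw : ∀ e, ∑ x ∈ T, w e x ≤ 64 := by
      intro e
      have := sum_pow_dist_mul_pow_dist_le (T.map (Function.Embedding.subtype cond)) e.1
      rwa [Finset.sum_map] at this
    have hwsymm : ∀ e x, w e x = w x e := fun e x => by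
      simp only [w, Nat.dist_comm]
    have hpair : ∀ e x, (uniformProduct A).real (E e ∩ E x) ≤
        (uniformProduct A).real (E e) * (uniformProduct A).real (E x) +
          (w e x * (uniformProduct A).real (E e) + w x e * (uniformProduct A).real (E x)) := by
      intro e x
      rw [← hwsymm e x, ← mul_add, hE, hE]
      obtain ⟨⟨l, n⟩, h1, h2, h3⟩ := e
      obtain ⟨⟨l', n'⟩, h1', h2', h3'⟩ := x
      exact real_recurrenceEvent_inter_le hA h1 h3 h1' h3'
    have hone : ∑ e ∈ T, ∑ x ∈ T, w e x * (uniformProduct A).real (E e) ≤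
        64 * ∑ e ∈ T, (uniformProduct A).real (E e) := by
      rw [Finset.mul_sum]
      refine Finset.sum_le_sum fun e _ => ?_
      rw [← Finset.sum_mul]
      exact mul_le_mul_of_nonneg_right (hw e) measureReal_nonneg
    calc ∑ e ∈ T, ∑ x ∈ T, (uniformProduct A).real (E e ∩ E x)
        ≤ ∑ e ∈ T, ∑ x ∈ T, ((uniformProduct A).real (E e) * (uniformProduct A).real (E x) +
          (w e x * (uniformProduct A).real (E e) + w x e * (uniformProduct A).real (E x))) :=
          Finset.sum_le_sum fun e _ => Finset.sum_le_sum fun x _ => hpair e x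
      _ = (∑ e ∈ T, (uniformProduct A).real (E e)) ^ 2 +
          (∑ e ∈ T, ∑ x ∈ T, w e x * (uniformProduct A).real (E e) +
            ∑ e ∈ T, ∑ x ∈ T, w x e * (uniformProduct A).real (E x)) := by
          simp only [Finset.sum_add_distrib, sq, Finset.sum_mul_sum]
      _ ≤ _ := by
          rw [Finset.sum_comm (f := fun e x => w x e * (uniformProduct A).real (E x))]
          linarith
  · intro M
    rw [not_summable_iff_tendsto_nat_atTop_of_nonneg
      fun n => Set.indicator_nonneg (fun _ _ => by positivity) n] at hdivH
    obtain ⟨N, hN⟩ := (hdivH.eventually_ge_atTop (4 * M)).exists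
    refine ⟨(Finset.range N ×ˢ Finset.range N).subtype cond, ?_⟩
    simp only [hE]
    rw [Finset.sum_subtype_eq_sum_filter (s := Finset.range N ×ˢ Finset.range N) (p := cond)
      (f := fun e => β ^ t e.2), Finset.sum_filter, Finset.sum_product_right]
    have : ∀ n ∈ Finset.range N, H.indicator (fun n => (n : ℝ) * β ^ t n) n ≤
        4 * ∑ l ∈ Finset.range N, if cond (l, n) then β ^ t n else 0 := by
      intro n hn
      rw [Finset.mem_range] at hn
      by_cases hH : n ∈ H
      · rw [Set.indicator_of_mem hH, ← Finset.sum_filter, Finset.sum_const, nsmul_eq_mul,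
          ← mul_assoc]
        refine mul_le_mul_of_nonneg_right ?_ (by positivity)
        have hcard : (n + 3) / 4 ≤ ((Finset.range N).filter fun l => cond (l, n)).card := by
          rw [← Finset.card_range ((n + 3) / 4)]
          refine Finset.card_le_card fun l hl => ?_
          rw [Finset.mem_range] at hl
          exact Finset.mem_filter.2 ⟨Finset.mem_range.2 (by omega), by dsimp only; omega, hH⟩
        exact_mod_cast (show n ≤ 4 * _ by omega)
      · rw [Set.indicator_of_notMem hH]
        exact mul_nonneg (by norm_num) (Finset.sum_nonneg fun l _ => by split_ifs <;> positivity)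
    have := Finset.sum_le_sum this
    rw [← Finset.mul_sum] at this
    linarith

end

/-! ### Codings of rational points -/

section Coding

variable {d : ℕ} {A : Type*}

theorem eventuallyPeriodic_of_lt {n : ℕ} (a : Fin n → A) (l : Fin n) {k : ℕ} (hk : k < n) :
    eventuallyPeriodic a l k = a ⟨k, hk⟩ := by
  unfold eventuallyPeriodic
  split_ifs with h
  · rfl
  · congr 2
    rw [Nat.mod_eq_of_lt (by omega)]
    omega

theorem eventuallyPeriodic_add {n : ℕ} (a : Fin n → A) (l : Fin n) {k : ℕ} (hk : (l : ℕ) ≤ k) :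
    eventuallyPeriodic a l (k + (n - l)) = eventuallyPeriodic a l k := by
  unfold eventuallyPeriodic
  rw [dif_neg (by omega), dif_neg (by omega)]
  congr 3
  rw [show k + (n - (l : ℕ)) - l = (k - l) + (n - l) by omega, Nat.add_mod_right]

/-- A sequence whose block at position `n` of length `t` repeats the block at position `l` agrees
with the sequence `ω_0 ⋯ ω_{l-1} (ω_l ⋯ ω_{n-1})^∞` on its first `n + t` letters. -/
theorem eventuallyPeriodic_eq_of_mem_recurrenceEvent {n t : ℕ} {ω : ℕ → A} (l : Fin n)
    (h : ω ∈ recurrenceEvent A l n t) {k : ℕ} (hk : k < n + t) :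
    eventuallyPeriodic (fun i : Fin n => ω i) l k = ω k := by
  induction k using Nat.strong_induction_on with
  | _ k ih =>
    rcases lt_or_ge k n with hkn | hkn
    · exact eventuallyPeriodic_of_lt _ _ hkn
    · have hl := l.isLt
      have h1 := eventuallyPeriodic_add (fun i : Fin n => ω i) l
        (show (l : ℕ) ≤ k - (n - l) by omega)
      rw [show k - (n - (l : ℕ)) + (n - l) = k by omega,
        ih (k - (n - l)) (by omega) (by omega)] at h1
      rw [h1]
      have h2 := h (k - n) (by omega)
      rwa [show (l : ℕ) + (k - n) = k - (n - l) by omega, show n + (k - n) = k by omega] at h2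

variable [Finite A] {q : ℤ} (hq : 2 ≤ |q|) (p : A → Fin d → ℤ)

theorem two_le_natAbs {q : ℤ} (hq : 2 ≤ |q|) : 2 ≤ q.natAbs := by
  zify
  exact hq

theorem norm_inv_eq (q : ℤ) : ‖(q : ℝ)⁻¹‖ = (q.natAbs : ℝ)⁻¹ := by
  rw [norm_inv, Real.norm_eq_abs, Nat.cast_natAbs, Int.cast_abs]

include hq

theorem cast_ne_zero_of_two_le : (q : ℝ) ≠ 0 := by
  have : q ≠ 0 := by rintro rfl; simp at hq
  exact_mod_cast this

theorem inv_pow_ne_one {m : ℕ} (hm : 0 < m) : (1 : ℝ) - (q : ℝ)⁻¹ ^ m ≠ 0 := by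
  intro h
  have h1 : ‖(q : ℝ)⁻¹‖ ^ m < 1 := pow_lt_one₀ (norm_nonneg _) (norm_inv_lt_one hq) hm.ne'
  rw [← norm_pow, ← sub_eq_zero.1 h, norm_one] at h1
  exact lt_irrefl _ h1

theorem codingMap_eq_prefixMap (a : ℕ → A) (n : ℕ) :
    codingMap q p a = prefixMap q p a n (codingMap q p fun i => a (n + i)) := by
  induction n with
  | zero => simp [prefixMap]
  | succ n ih =>
    rw [prefixMap, Function.comp, ih]
    congr 1
    rw [ifsMap_codingMap hq]
    congr 3
    funext i
    congr 1
    omega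

theorem codingMap_eq_sum_add (a : ℕ → A) (n : ℕ) : codingMap q p a =
    ∑ k ∈ Finset.range n, ((q : ℝ)⁻¹ ^ (k + 1)) • intVec (p (a k)) +
      ((q : ℝ)⁻¹ ^ n) • codingMap q p fun i => a (n + i) := by
  rw [← prefixMap_apply]
  exact codingMap_eq_prefixMap hq p a n

/-- Sequences that share a prefix of length `m` code points at distance `O(|q|^(-m))`. -/
theorem exists_norm_codingMap_sub_le : ∃ D : ℝ, 0 < D ∧ ∀ (a a' : ℕ → A) (m : ℕ),
    (∀ i < m, a i = a' i) → ‖codingMap q p a - codingMap q p a'‖ ≤ D * (q.natAbs : ℝ)⁻¹ ^ m := by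
  obtain ⟨C, hC⟩ := (isCompact_selfSimilarSet hq p).isBounded.exists_norm_le
  refine ⟨2 * |C| + 1, by positivity, fun a a' m h => ?_⟩
  rw [codingMap_eq_sum_add hq p a m, codingMap_eq_sum_add hq p a' m,
    Finset.sum_congr rfl fun k hk => by rw [h k (Finset.mem_range.1 hk)], add_sub_add_left_eq_sub,
    ← smul_sub, norm_smul, norm_pow, norm_inv_eq, mul_comm]
  refine mul_le_mul_of_nonneg_right ((norm_sub_le _ _).trans ?_) (by positivity)
  have h1 := hC (codingMap q p fun i => a (m + i)) ⟨_, rfl⟩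
  have h2 := hC (codingMap q p fun i => a' (m + i)) ⟨_, rfl⟩
  linarith [le_abs_self C]

omit hq [Finite A] in
theorem IsRationalPoint.add {x y : EuclideanSpace ℝ (Fin d)} (hx : IsRationalPoint x)
    (hy : IsRationalPoint y) : IsRationalPoint (x + y) := fun i => by
  obtain ⟨r, hr⟩ := hx i
  obtain ⟨s, hs⟩ := hy i
  exact ⟨r + s, by simp [hr, hs]⟩

omit hq [Finite A] in
theorem IsRationalPoint.smul {x : EuclideanSpace ℝ (Fin d)} (hx : IsRationalPoint x) (c : ℚ) :
    IsRationalPoint ((c : ℝ) • x) := fun i => by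
  obtain ⟨r, hr⟩ := hx i
  exact ⟨c * r, by simp [hr]⟩

omit hq [Finite A] in
theorem isRationalPoint_intVec (v : Fin d → ℤ) : IsRationalPoint (intVec v) := fun i =>
  ⟨v i, by simp [intVec]⟩

omit hq [Finite A] in
theorem isRationalPoint_prefix_sum (q : ℤ) (p : A → Fin d → ℤ) (a : ℕ → A) (n : ℕ) :
    IsRationalPoint (∑ k ∈ Finset.range n, ((q : ℝ)⁻¹ ^ (k + 1)) • intVec (p (a k))) := by
  induction n with
  | zero => exact fun i => ⟨0, by simp⟩
  | succ n ih =>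
    rw [Finset.sum_range_succ]
    refine ih.add ?_
    have := (isRationalPoint_intVec (p (a n))).smul ((q : ℚ)⁻¹ ^ (n + 1))
    push_cast at this
    exact this

/-- A point whose coding is fixed by the `m`-th iterate of the shift solves a linear equation. -/
theorem codingMap_of_periodic {a : ℕ → A} {m : ℕ} (hm : 0 < m)
    (ha : codingMap q p (fun i => a (m + i)) = codingMap q p a) : codingMap q p a =
      ((1 : ℝ) - (q : ℝ)⁻¹ ^ m)⁻¹ •
        ∑ k ∈ Finset.range m, ((q : ℝ)⁻¹ ^ (k + 1)) • intVec (p (a k)) := by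
  have h := codingMap_eq_sum_add hq p a m
  rw [ha] at h
  rw [eq_inv_smul_iff₀ (inv_pow_ne_one hq hm), sub_smul, one_smul, sub_eq_iff_eq_add]
  exact h

omit hq [Finite A] in
theorem eventuallyPeriodic_shift {n : ℕ} (a : Fin n → A) (l : Fin n) :
    (fun i => eventuallyPeriodic a l (l + ((n - l) + i))) =
      fun i => eventuallyPeriodic a l (l + i) := by
  funext i
  rw [← eventuallyPeriodic_add a l (k := l + i) (by omega)]
  congr 1
  omega

theorem isRationalPoint_codingMap_eventuallyPeriodic {n : ℕ} (a : Fin n → A) (l : Fin n) :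
    IsRationalPoint (codingMap q p (eventuallyPeriodic a l)) := by
  rw [codingMap_eq_sum_add hq p _ l]
  refine (isRationalPoint_prefix_sum q p _ _).add ?_
  have h := codingMap_of_periodic hq p (a := fun i => eventuallyPeriodic a l (l + i))
    (m := n - l) (Nat.sub_pos_of_lt l.isLt) (by rw [eventuallyPeriodic_shift])
  rw [h]
  have h1 := (isRationalPoint_prefix_sum q p (fun i => eventuallyPeriodic a l (l + i))
    (n - l)).smul (1 - (q : ℚ)⁻¹ ^ (n - (l : ℕ)))⁻¹
  have h2 := h1.smul ((q : ℚ)⁻¹ ^ (l : ℕ))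
  push_cast at h2
  exact h2

/-- Every rational point of `X` has an eventually periodic coding: the tails of a coding of `y`
code points with the same denominators as `y`, of which `X` contains only finitely many. -/
theorem exists_eventuallyPeriodic {y : EuclideanSpace ℝ (Fin d)} (hy : y ∈ selfSimilarSet q p)
    (hr : IsRationalPoint y) : ∃ (n : ℕ) (a : Fin n → A) (l : Fin n),
      y = codingMap q p (eventuallyPeriodic a l) := by
  obtain ⟨ω, rfl⟩ := hy
  choose r hr using hr
  let N : ℕ := ∏ i, (r i).den
  have hN : 0 < N := Finset.prod_pos fun i _ => (r i).den_pos
  have hNR : (0 : ℝ) < N := by exact_mod_cast hN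
  have hint : ∀ n, ∃ v : Fin d → ℤ,
      (N : ℝ) • codingMap q p (fun i => ω (n + i)) = intVec v := by
    intro n
    induction n with
    | zero =>
      refine ⟨fun i => (r i).num * ∏ j ∈ Finset.univ.erase i, ((r j).den : ℤ), ?_⟩
      ext i
      have h1 : (N : ℝ) = (r i).den * ∏ j ∈ Finset.univ.erase i, ((r j).den : ℝ) := by
        simp only [N]
        rw [← Finset.mul_prod_erase _ _ (Finset.mem_univ i)]
        push_cast
        rfl
      have h2 : ((r i).den : ℝ) * (r i : ℝ) = (r i).num := by
        exact_mod_cast Rat.den_mul_eq_num (r i)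
      simp only [zero_add, PiLp.smul_apply, smul_eq_mul, hr, intVec]
      push_cast
      rw [h1, ← h2]
      ring
    | succ n ih =>
      obtain ⟨v, hv⟩ := ih
      refine ⟨fun i => q * v i - N * p (ω n) i, ?_⟩
      have h1 := ifsMap_codingMap hq p fun i => ω (n + i)
      have h2 : (fun i => ω (n + (i + 1))) = fun i => ω (n + 1 + i) := by
        funext i
        congr 1
        omega
      rw [h2, ifsMap, eq_inv_smul_iff₀ (cast_ne_zero_of_two_le hq)] at h1
      ext i
      have h3 := congrArg (fun x : EuclideanSpace ℝ (Fin d) => x i) h1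
      have h4 := congrArg (fun x : EuclideanSpace ℝ (Fin d) => x i) hv
      simp only [PiLp.smul_apply, PiLp.add_apply, smul_eq_mul, intVec, add_zero] at h3 h4 ⊢
      push_cast
      rw [← h4]
      linear_combination (-(N : ℝ)) * h3
  obtain ⟨C, hC⟩ := (isCompact_selfSimilarSet hq p).isBounded.exists_norm_le
  let K : ℤ := ⌈N * C⌉
  let F : Set (EuclideanSpace ℝ (Fin d)) :=
    (fun v => (N : ℝ)⁻¹ • intVec v) '' Set.Icc (fun _ => -K) (fun _ => K)
  have hF : F.Finite := (Set.finite_Icc _ _).image _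
  have hmem : ∀ n, codingMap q p (fun i => ω (n + i)) ∈ F := by
    intro n
    obtain ⟨v, hv⟩ := hint n
    have hvK : ∀ i, |v i| ≤ K := by
      intro i
      have h1 : |(v i : ℝ)| ≤ N * C := by
        calc |(v i : ℝ)| = ‖intVec v i‖ := by simp [intVec]
          _ ≤ ‖intVec v‖ := PiLp.norm_apply_le _ i
          _ = N * ‖codingMap q p (fun i => ω (n + i))‖ := by
            rw [← hv, norm_smul, Real.norm_of_nonneg hNR.le]
          _ ≤ N * C := mul_le_mul_of_nonneg_left (hC _ ⟨_, rfl⟩) hNR.le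
      have h2 : ((|v i| : ℤ) : ℝ) ≤ (K : ℝ) := by
        rw [Int.cast_abs]
        exact h1.trans (Int.le_ceil _)
      exact_mod_cast h2
    refine ⟨v, ⟨fun i => (abs_le.1 (hvK i)).1, fun i => (abs_le.1 (hvK i)).2⟩, ?_⟩
    dsimp only
    rw [← hv, inv_smul_smul₀ hNR.ne']
  obtain ⟨l, n, hln, heq⟩ := hF.exists_lt_map_eq_of_forall_mem hmem
  refine ⟨n, fun i => ω i, ⟨l, hln⟩, ?_⟩
  set e := eventuallyPeriodic (fun i : Fin n => ω i) ⟨l, hln⟩ with he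
  have hag : ∀ k < n, e k = ω k := fun k hk => eventuallyPeriodic_of_lt _ _ hk
  have h1 : codingMap q p (fun i => ω (l + i)) = codingMap q p (fun i => e (l + i)) := by
    rw [codingMap_of_periodic hq p (a := fun i => ω (l + i)) (Nat.sub_pos_of_lt hln),
      codingMap_of_periodic hq p (a := fun i => e (l + i)) (Nat.sub_pos_of_lt hln)]
    · congr 1
      refine Finset.sum_congr rfl fun k hk => ?_
      rw [hag _ (by have := Finset.mem_range.1 hk; omega)]
    · rw [he]
      exact congrArg _ (eventuallyPeriodic_shift (fun i : Fin n => ω i) ⟨l, hln⟩)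
    · rw [heq]
      congr 1
      funext i
      congr 1
      omega
  rw [codingMap_eq_sum_add hq p ω l, codingMap_eq_sum_add hq p e l, h1]
  congr 1
  refine Finset.sum_congr rfl fun k hk => ?_
  rw [hag _ ((Finset.mem_range.1 hk).trans hln)]

/-! ### Bounds for the intrinsic denominator -/

omit [Finite A] in
theorem pow_le_natAbs_denom {n l : ℕ} (hl : l < n) :
    q.natAbs ^ (n - 1) ≤ (q ^ l * (q ^ (n - l) - 1)).natAbs := by
  obtain ⟨m, rfl⟩ : ∃ m, n = l + (m + 1) := ⟨n - l - 1, by omega⟩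
  rw [Int.natAbs_mul, Int.natAbs_pow, show l + (m + 1) - 1 = l + m by omega,
    show l + (m + 1) - l = m + 1 by omega, pow_add]
  refine Nat.mul_le_mul_left _ ?_
  have h1 : (q ^ (m + 1)).natAbs ≤ (q ^ (m + 1) - 1).natAbs + 1 := by omega
  rw [Int.natAbs_pow, pow_succ] at h1
  have h2 := Nat.mul_le_mul_left (q.natAbs ^ m) (two_le_natAbs hq)
  have h3 : 0 < q.natAbs ^ m := pow_pos (by have := two_le_natAbs hq; omega) _
  omega

omit [Finite A] in
theorem natAbs_denom_le {n l : ℕ} (hl : l < n) :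
    (q ^ l * (q ^ (n - l) - 1)).natAbs ≤ q.natAbs ^ (n + 1) := by
  rw [Int.natAbs_mul, Int.natAbs_pow, show n + 1 = l + (n - l + 1) by omega, pow_add]
  refine Nat.mul_le_mul_left _ ?_
  have h1 : (q ^ (n - l) - 1).natAbs ≤ (q ^ (n - l)).natAbs + 1 := by omega
  rw [Int.natAbs_pow] at h1
  have h2 := Nat.mul_le_mul_left (q.natAbs ^ (n - l)) (two_le_natAbs hq)
  have h3 : 0 < q.natAbs ^ (n - l) := pow_pos (by have := two_le_natAbs hq; omega) _
  rw [pow_succ]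
  omega

/-- The infimum that defines the intrinsic denominator of a rational point is attained. -/
theorem exists_intrinsicDenom_eq {y : EuclideanSpace ℝ (Fin d)} (hy : y ∈ selfSimilarSet q p)
    (hr : IsRationalPoint y) : ∃ (n : ℕ) (a : Fin n → A) (l : Fin n),
      y = codingMap q p (eventuallyPeriodic a l) ∧
        intrinsicDenom q p y = (q ^ (l : ℕ) * (q ^ (n - (l : ℕ)) - 1)).natAbs := by
  obtain ⟨n, a, l, h⟩ := exists_eventuallyPeriodic hq p hy hr
  exact Nat.sInf_mem (s := {Q : ℕ | ∃ (n : ℕ) (a : Fin n → A) (l : Fin n),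
    y = codingMap q p (eventuallyPeriodic a l) ∧
      Q = (q ^ (l : ℕ) * (q ^ (n - (l : ℕ)) - 1)).natAbs}) ⟨_, n, a, l, h, rfl⟩

end Coding

/-! ### Convergence: the Hausdorff measure -/

section Convergence

variable {d : ℕ} {A : Type*}

/-- For every `N`, the balls of radius `Ψ(|q|^(n-1))` around the points coded by the eventually
periodic words of length `n > N` cover the well-approximable points. -/
theorem intrinsicWellApprox_subset_iUnion [Finite A] {q : ℤ} (hq : 2 ≤ |q|) (p : A → Fin d → ℤ)
    {Ψ : ℕ → ℝ≥0} (hΨ : AntitoneOn Ψ (Set.Ici 1)) (N : ℕ) :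
    intrinsicWellApprox q p Ψ ⊆
      ⋃ i : Σ m : ℕ, (Fin (N + 1 + m) → A) × Fin (N + 1 + m),
        Metric.eball (codingMap q p (eventuallyPeriodic i.2.1 i.2.2))
          (Ψ (q.natAbs ^ (N + i.1)) : ℝ≥0∞) := by
  rintro x ⟨-, hinf⟩
  have hfin : (Set.range fun i : Σ n : Fin (N + 1), (Fin n → A) × Fin n =>
      codingMap q p (eventuallyPeriodic i.2.1 i.2.2)).Finite := Set.finite_range _
  obtain ⟨y, ⟨hy, hyr, hxy⟩, hynot⟩ := (hinf.sdiff hfin).nonempty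
  obtain ⟨n, a, l, rfl, hden⟩ := exists_intrinsicDenom_eq hq p hy hyr
  have hn : N + 1 ≤ n := by
    by_contra hlt
    exact hynot ⟨⟨⟨n, by omega⟩, a, l⟩, rfl⟩
  obtain ⟨m, rfl⟩ := Nat.exists_eq_add_of_le hn
  refine Set.mem_iUnion.2 ⟨⟨m, a, l⟩, ?_⟩
  rw [Metric.eball_coe, Metric.mem_ball, dist_eq_norm]
  refine hxy.trans_le ?_
  have hpow := pow_le_natAbs_denom hq l.isLt
  rw [show N + 1 + m - 1 = N + m by omega] at hpow
  have hone : 1 ≤ q.natAbs ^ (N + m) :=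
    Nat.one_le_pow _ _ (by have := two_le_natAbs hq; omega)
  rw [hden]
  exact_mod_cast hΨ (Set.mem_Ici.2 hone) (Set.mem_Ici.2 (hone.trans hpow)) hpow

theorem hausdorffMeasure_intrinsicWellApprox_eq_zero [Fintype A] [Nonempty A] {q : ℤ}
    (hq : 2 ≤ |q|) (p : A → Fin d → ℤ) {Ψ : ℕ → ℝ≥0} (hΨ : AntitoneOn Ψ (Set.Ici 1)) {s : ℝ}
    (hs : 0 ≤ s) (hsum : ∑' n : ℕ, (n : ℝ≥0∞) * (Fintype.card A : ℝ≥0∞) ^ n *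
      (Ψ (q.natAbs ^ n) : ℝ≥0∞) ^ s < ∞) :
    Measure.hausdorffMeasure s (intrinsicWellApprox q p Ψ) = 0 := by
  set b : ℝ≥0∞ := (Fintype.card A : ℝ≥0∞) with hb
  set g : ℕ → ℝ≥0∞ := fun n => (n : ℝ≥0∞) * b ^ n * (Ψ (q.natAbs ^ n) : ℝ≥0∞) ^ s with hg
  have hb1 : 1 ≤ b := by
    rw [hb]
    exact_mod_cast Fintype.card_pos (α := A)
  have hlim1 : Tendsto (fun n => (Ψ (q.natAbs ^ n) : ℝ≥0∞) ^ s) atTop (𝓝 0) := by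
    refine tendsto_of_tendsto_of_tendsto_of_le_of_le' tendsto_const_nhds
      (ENNReal.tendsto_atTop_zero_of_tsum_ne_top hsum.ne) (Eventually.of_forall fun _ => zero_le)
      ((eventually_ge_atTop 1).mono fun n hn => ?_)
    have h1 : (1 : ℝ≥0∞) ≤ n := by exact_mod_cast hn
    exact le_mul_of_one_le_left zero_le (one_le_mul h1 (one_le_pow₀ hb1))
  have hs0 : 0 < s := by
    refine lt_of_le_of_ne hs fun h => ?_
    simp only [← h, ENNReal.rpow_zero] at hlim1
    exact one_ne_zero (tendsto_nhds_unique tendsto_const_nhds hlim1)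
  have hlim2 : Tendsto (fun n => (Ψ (q.natAbs ^ n) : ℝ≥0∞)) atTop (𝓝 0) := by
    have h := (ENNReal.continuous_rpow_const (y := s⁻¹)).tendsto 0 |>.comp hlim1
    rw [ENNReal.zero_rpow_of_pos (inv_pos.2 hs0)] at h
    refine h.congr fun n => ?_
    simp only [Function.comp]
    rw [← ENNReal.rpow_mul, mul_inv_cancel₀ hs0.ne', ENNReal.rpow_one]
  have hanti : ∀ N m, Ψ (q.natAbs ^ (N + m)) ≤ Ψ (q.natAbs ^ N) := by
    intro N m
    have h0 : 0 < q.natAbs := by have := two_le_natAbs hq; omega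
    exact hΨ (Set.mem_Ici.2 (Nat.one_le_pow _ _ h0)) (Set.mem_Ici.2 (Nat.one_le_pow _ _ h0))
      (Nat.pow_le_pow_right h0 (Nat.le_add_right N m))
  have hle := Measure.hausdorffMeasure_le_liminf_tsum s (intrinsicWellApprox q p Ψ) (l := atTop)
    (fun N => 2 * (Ψ (q.natAbs ^ N) : ℝ≥0∞))
    (by simpa using ENNReal.Tendsto.const_mul hlim2 (Or.inr ENNReal.ofNat_ne_top))
    (fun N (i : Σ m : ℕ, (Fin (N + 1 + m) → A) × Fin (N + 1 + m)) =>
      Metric.eball (codingMap q p (eventuallyPeriodic i.2.1 i.2.2))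
        (Ψ (q.natAbs ^ (N + i.1)) : ℝ≥0∞))
    (Eventually.of_forall fun N i => Metric.ediam_eball_le.trans (by
      gcongr
      exact hanti N i.1))
    (Eventually.of_forall fun N => intrinsicWellApprox_subset_iUnion hq p hΨ N)
  refine le_antisymm (hle.trans ?_) zero_le
  set K : ℝ≥0∞ := 2 * b * 2 ^ s with hK
  have hKtop : K ≠ ∞ := by
    refine ENNReal.mul_ne_top (ENNReal.mul_ne_top ENNReal.ofNat_ne_top (by simp [hb])) ?_
    exact ENNReal.rpow_ne_top_of_nonneg hs ENNReal.ofNat_ne_top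
  have htail : Tendsto (fun N => K * ∑' m, g (m + N)) atTop (𝓝 0) := by
    simpa using ENNReal.Tendsto.const_mul (ENNReal.tendsto_sum_nat_add g hsum.ne) (Or.inr hKtop)
  rw [← htail.liminf_eq]
  refine liminf_le_liminf ((eventually_ge_atTop 1).mono fun N hN => ?_)
  rw [ENNReal.tsum_sigma', ← ENNReal.tsum_mul_left]
  refine ENNReal.tsum_le_tsum fun m => ?_
  calc ∑' i : (Fin (N + 1 + m) → A) × Fin (N + 1 + m),
        Metric.ediam (Metric.eball (codingMap q p (eventuallyPeriodic i.1 i.2))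
          (Ψ (q.natAbs ^ (N + m)) : ℝ≥0∞)) ^ s
      ≤ ∑' _ : (Fin (N + 1 + m) → A) × Fin (N + 1 + m),
          (2 * (Ψ (q.natAbs ^ (N + m)) : ℝ≥0∞)) ^ s :=
        ENNReal.tsum_le_tsum fun i => ENNReal.rpow_le_rpow Metric.ediam_eball_le hs
    _ = b ^ (N + 1 + m) * ((N + 1 + m : ℕ) : ℝ≥0∞) *
          (2 ^ s * (Ψ (q.natAbs ^ (N + m)) : ℝ≥0∞) ^ s) := by
        rw [tsum_fintype, Finset.sum_const, nsmul_eq_mul, Finset.card_univ, Fintype.card_prod,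
          Fintype.card_fun, Fintype.card_fin, ENNReal.mul_rpow_of_nonneg _ _ hs]
        push_cast
        rfl
    _ ≤ b ^ (N + 1 + m) * ((2 * (m + N) : ℕ) : ℝ≥0∞) *
          (2 ^ s * (Ψ (q.natAbs ^ (N + m)) : ℝ≥0∞) ^ s) := by
        gcongr
        omega
    _ = K * g (m + N) := by
        rw [hK, hg]
        simp only
        rw [show N + 1 + m = m + N + 1 by omega, add_comm N m, pow_succ]
        push_cast
        ring

end Convergence

/-! ### The self-similar measure has no atoms -/

section Atoms

variable {d : ℕ} {A : Type*}

theorem measurable_codingMap_of_discrete [Finite A] [m : MeasurableSpace A]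
    [DiscreteMeasurableSpace A] {q : ℤ} (hq : 2 ≤ |q|) (p : A → Fin d → ℤ) :
    Measurable (codingMap q p) := by
  obtain rfl : m = ⊤ := le_antisymm le_top fun _ _ => .of_discrete
  exact measurable_codingMap hq p

/-- Changing one letter of a coding moves the point by a known vector. -/
theorem codingMap_permute [Finite A] {q : ℤ} (hq : 2 ≤ |q|) (p : A → Fin d → ℤ) (k : ℕ)
    (τ : Equiv.Perm A) (ω : ℕ → A) : codingMap q p (fun i => if i = k then τ (ω i) else ω i) =
      codingMap q p ω + (q : ℝ)⁻¹ ^ (k + 1) • (intVec (p (τ (ω k))) - intVec (p (ω k))) := by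
  rw [codingMap_eq_sum_add hq p ω (k + 1), codingMap_eq_sum_add hq p _ (k + 1),
    Finset.sum_range_succ, Finset.sum_range_succ, smul_sub]
  have h1 : (fun i => if k + 1 + i = k then τ (ω (k + 1 + i)) else ω (k + 1 + i)) =
      fun i => ω (k + 1 + i) := by
    funext i
    rw [if_neg (by omega)]
  rw [h1, Finset.sum_congr rfl fun i hi => by
    rw [if_neg (by have := Finset.mem_range.1 hi; omega)], if_pos rfl]
  abel

theorem intVec_injective : Function.Injective (intVec : (Fin d → ℤ) → _) := by
  intro v w h
  funext i
  have := congrArg (fun x : EuclideanSpace ℝ (Fin d) => x i) h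
  simpa [intVec] using this

variable [Fintype A] [Nonempty A] [MeasurableSpace A] [DiscreteMeasurableSpace A]

/-- The codings of a fixed point `y` form a null set. Exchanging the letter `c` at position `k` for
a letter `c'` with `p c ≠ p c'` maps the codings of `y` with letter `c` at `k` to codings of a point
that depends on `k` injectively. The images are disjoint, so that their measures tend to zero. -/
theorem uniformProduct_codingMap_eq_zero {q : ℤ} (hq : 2 ≤ |q|) (p : A → Fin d → ℤ)
    (hp : ∃ a b, p a ≠ p b) (y : EuclideanSpace ℝ (Fin d)) :
    uniformProduct A {ω | codingMap q p ω = y} = 0 := by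
  classical
  have hπ := measurable_codingMap_of_discrete hq p
  let Z : A → ℕ → Set (ℕ → A) := fun c k => codingMap q p ⁻¹' {y} ∩ (fun ω => ω k) ⁻¹' {c}
  have hZm : ∀ c k, MeasurableSet (Z c k) := fun c k =>
    (hπ (measurableSet_singleton y)).inter (measurable_pi_apply k (measurableSet_singleton c))
  have hlim : ∀ c, Tendsto (fun k => uniformProduct A (Z c k)) atTop (𝓝 0) := by
    intro c
    obtain ⟨c', hc'⟩ : ∃ c', p c ≠ p c' := by
      obtain ⟨a, b, hab⟩ := hp
      by_contra! h
      exact hab ((h a).symm.trans (h b))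
    let T : ℕ → (ℕ → A) → (ℕ → A) := fun k ω i => if i = k then Equiv.swap c c' (ω i) else ω i
    have hT : ∀ k, uniformProduct A (T k ⁻¹' Z c k) = uniformProduct A (Z c k) := fun k =>
      (measurePreserving_permute k (Equiv.swap c c')).measure_preimage
        (hZm c k).nullMeasurableSet
    have hval : ∀ k, ∀ ω ∈ T k ⁻¹' Z c k,
        codingMap q p ω = y + (q : ℝ)⁻¹ ^ (k + 1) • (intVec (p c') - intVec (p c)) := by
      rintro k ω ⟨h1, h2⟩
      have h3 : ω k = c' := by
        have : Equiv.swap c c' (ω k) = c := by simpa [T] using h2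
        rw [Equiv.swap_apply_eq_iff, Equiv.swap_apply_left] at this
        exact this
      have h4 := codingMap_permute hq p k (Equiv.swap c c') ω
      rw [h3, Equiv.swap_apply_right] at h4
      rw [← h1]
      simp only [T]
      rw [h4, smul_sub, smul_sub]
      abel
    have hdisj : Pairwise fun j k => Disjoint (T j ⁻¹' Z c j) (T k ⁻¹' Z c k) := by
      intro j k hjk
      rw [Set.disjoint_left]
      intro ω hj hk
      have h1 := (hval j ω hj).symm.trans (hval k ω hk)
      have hv : intVec (p c') - intVec (p c) ≠ 0 :=
        sub_ne_zero.2 fun h => hc' (intVec_injective h).symm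
      have h2 := smul_left_injective ℝ hv (add_left_cancel h1)
      have h3 := congrArg norm h2
      simp only [norm_pow] at h3
      have h4 := (pow_right_strictAnti₀ (norm_pos_iff.2
        (inv_ne_zero (cast_ne_zero_of_two_le hq))) (norm_inv_lt_one hq)).injective h3
      omega
    have hsum : ∑' k, uniformProduct A (Z c k) ≠ ∞ := by
      simp only [← hT]
      refine ne_top_of_le_ne_top ENNReal.one_ne_top ?_
      rw [← measure_univ (μ := uniformProduct A)]
      exact tsum_measure_le_measure_univ
        (fun k => ((measurePreserving_permute k (Equiv.swap c c')).measurable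
          (hZm c k)).nullMeasurableSet)
        fun j k hjk => (hdisj hjk).aedisjoint
    exact ENNReal.tendsto_atTop_zero_of_tsum_ne_top hsum
  have hsum : Tendsto (fun k => ∑ c, uniformProduct A (Z c k)) atTop (𝓝 0) := by
    simpa using tendsto_finsetSum Finset.univ fun c _ => hlim c
  refine le_antisymm (ge_of_tendsto' hsum fun k => ?_) zero_le
  refine le_trans (measure_mono fun ω hω => ?_)
    (measure_biUnion_finset_le Finset.univ fun c => Z c k)
  exact Set.mem_biUnion (Finset.mem_univ (ω k)) ⟨hω, rfl⟩

theorem countable_isRationalPoint :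
    {x : EuclideanSpace ℝ (Fin d) | IsRationalPoint x}.Countable := by
  refine (Set.countable_range fun r : Fin d → ℚ =>
    (WithLp.toLp 2 fun i => (r i : ℝ) : EuclideanSpace ℝ (Fin d))).mono fun x hx => ?_
  choose r hr using hx
  exact ⟨r, by ext i; simp [hr]⟩

theorem ae_not_isRationalPoint {q : ℤ} (hq : 2 ≤ |q|) (p : A → Fin d → ℤ)
    (hp : ∃ a b, p a ≠ p b) :
    ∀ᵐ ω ∂uniformProduct A, ¬ IsRationalPoint (codingMap q p ω) := by
  have h : ∀ᵐ ω ∂uniformProduct A, ∀ y ∈ {x : EuclideanSpace ℝ (Fin d) | IsRationalPoint x},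
      codingMap q p ω ≠ y :=
    (ae_ball_iff countable_isRationalPoint).2 fun y _ =>
      measure_eq_zero_iff_ae_notMem.1 (uniformProduct_codingMap_eq_zero hq p hp y)
  filter_upwards [h] with ω hω hr
  exact hω _ hr rfl

end Atoms

/-! ### Divergence: the self-similar measure -/

section Divergence

/-- The first time at which the geometric sequence `D * Q^(-(n + t))` drops below `ψ (n + 1)`
satisfies the divergence hypothesis of the recurrence theorem, if `∑ n b^n ψ(n)^(log b / log Q)`
diverges: unless it is zero, the time before it gives an upper bound for `ψ (n + 1)`. -/
theorem exists_time_of_tsum_eq_top {b Q : ℕ} (hb : 2 ≤ b) (hQ : 2 ≤ Q) {D : ℝ} (hD : 0 < D)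
    (ψ : ℕ → ℝ≥0) (hsum : ∑' n : ℕ, (n : ℝ≥0∞) * (b : ℝ≥0∞) ^ n *
      (ψ n : ℝ≥0∞) ^ (Real.log b / Real.log Q) = ∞) :
    ∃ t : ℕ → ℕ, (∀ n, 0 < ψ (n + 1) → D * (Q : ℝ)⁻¹ ^ (n + t n) < ψ (n + 1)) ∧
      ¬ Summable ({n | 0 < ψ (n + 1)}.indicator fun n => (n : ℝ) * (b : ℝ)⁻¹ ^ t n) := by
  classical
  have hbR : (2 : ℝ) ≤ b := by exact_mod_cast hb
  have hQR : (2 : ℝ) ≤ Q := by exact_mod_cast hQ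
  have hb0 : (0 : ℝ) < b := by linarith
  set s : ℝ := Real.log b / Real.log Q with hs
  have hs0 : 0 < s := div_pos (Real.log_pos (by linarith)) (Real.log_pos (by linarith))
  have hQs : (Q : ℝ) ^ s = b := Real.rpow_logb (by linarith) (by linarith) hb0
  have hgeo : ∀ m : ℕ, (D * (Q : ℝ)⁻¹ ^ m) ^ s = D ^ s * (b : ℝ)⁻¹ ^ m := by
    intro m
    rw [Real.mul_rpow hD.le (by positivity), ← Real.rpow_natCast, ← Real.rpow_mul (by positivity),
      mul_comm (m : ℝ), Real.rpow_mul (by positivity), Real.inv_rpow (by positivity), hQs,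
      Real.rpow_natCast]
  have hex : ∀ n, 0 < ψ (n + 1) → ∃ t : ℕ, D * (Q : ℝ)⁻¹ ^ (n + t) < ψ (n + 1) := by
    intro n hn
    have hlim : Tendsto (fun t : ℕ => D * (Q : ℝ)⁻¹ ^ (n + t)) atTop (𝓝 0) := by
      have h := (tendsto_pow_atTop_nhds_zero_of_lt_one (r := (Q : ℝ)⁻¹) (by positivity)
        (inv_lt_one_of_one_lt₀ (by linarith))).const_mul (D * (Q : ℝ)⁻¹ ^ n)
      rw [mul_zero] at h
      exact h.congr fun t => by rw [pow_add, mul_assoc]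
    exact (hlim.eventually_lt_const (by exact_mod_cast hn)).exists
  let t : ℕ → ℕ := fun n => if h : 0 < ψ (n + 1) then Nat.find (hex n h) else 0
  have ht : ∀ n, 0 < ψ (n + 1) → D * (Q : ℝ)⁻¹ ^ (n + t n) < ψ (n + 1) := by
    intro n hn
    simp only [t, dif_pos hn]
    exact Nat.find_spec (hex n hn)
  refine ⟨t, ht, fun hsummable => ?_⟩
  set I : ℕ → ℝ := {n | 0 < ψ (n + 1)}.indicator fun n => (n : ℝ) * (b : ℝ)⁻¹ ^ t n with hI
  have hI0 : ∀ n, 0 ≤ I n := fun n => Set.indicator_nonneg (fun _ _ => by positivity) n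
  let f : ℕ → ℝ := fun n => (n : ℝ) * (b : ℝ) ^ n * (ψ n : ℝ) ^ s
  have hf0 : ∀ n, 0 ≤ f n := fun n => by positivity
  have hbound : ∀ᶠ n in atTop, f (n + 1) ≤ 2 * b ^ 2 * D ^ s * I n := by
    filter_upwards [hsummable.tendsto_atTop_zero.eventually_lt_const one_pos,
      eventually_ge_atTop 1] with n hn1 hn
    rcases eq_or_ne (ψ (n + 1)) 0 with h0 | h0
    · have : f (n + 1) = 0 := by simp [f, h0, Real.zero_rpow hs0.ne']
      rw [this]
      exact mul_nonneg (by positivity) (hI0 n)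
    have hpos : 0 < ψ (n + 1) := pos_iff_ne_zero.2 h0
    have hmem : n ∈ {n | 0 < ψ (n + 1)} := hpos
    have hIn : I n = (n : ℝ) * (b : ℝ)⁻¹ ^ t n := Set.indicator_of_mem hmem _
    have hnR : (1 : ℝ) ≤ n := by exact_mod_cast hn
    -- The terms of a convergent series are eventually less than `1`, which excludes `t n = 0`.
    have ht0 : t n ≠ 0 := by
      intro h
      rw [hIn, h, pow_zero, mul_one] at hn1
      linarith
    obtain ⟨u, hu⟩ := Nat.exists_eq_succ_of_ne_zero ht0
    have hmin : (ψ (n + 1) : ℝ) ≤ D * (Q : ℝ)⁻¹ ^ (n + u) := by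
      have h1 : t n = Nat.find (hex n hpos) := dif_pos hpos
      exact not_lt.1 (Nat.find_min (hex n hpos) (by omega))
    have hψ : (ψ (n + 1) : ℝ) ^ s ≤ D ^ s * (b : ℝ)⁻¹ ^ (n + u) := by
      rw [← hgeo]
      exact Real.rpow_le_rpow (by positivity) hmin hs0.le
    calc f (n + 1) ≤ (2 * n) * (b : ℝ) ^ (n + 1) * (D ^ s * (b : ℝ)⁻¹ ^ (n + u)) := by
          refine mul_le_mul (mul_le_mul_of_nonneg_right ?_ (by positivity)) hψ (by positivity)
            (by positivity)
          push_cast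
          linarith
      _ = 2 * b ^ 2 * D ^ s * I n := by
          rw [hIn, hu, Nat.succ_eq_add_one, pow_add, pow_add _ n, pow_add _ u]
          have h1 : (b : ℝ) * (b : ℝ)⁻¹ = 1 := mul_inv_cancel₀ hb0.ne'
          have h2 : (b : ℝ) ^ n * (b : ℝ)⁻¹ ^ n = 1 := by rw [← mul_pow, h1, one_pow]
          generalize (b : ℝ)⁻¹ = β at h1 h2 ⊢
          linear_combination (2 * n * b * D ^ s * β ^ u) * h2 - (2 * n * b * D ^ s * β ^ u) * h1
  have hfs : Summable f := by
    rw [← summable_nat_add_iff 1]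
    refine Summable.of_norm_bounded_eventually_nat (hsummable.mul_left (2 * b ^ 2 * D ^ s))
      (hbound.mono fun n hn => ?_)
    rwa [Real.norm_of_nonneg (hf0 _)]
  refine hfs.tsum_ofReal_ne_top (Eq.trans (tsum_congr fun n => ?_) hsum)
  simp only [f]
  rw [ENNReal.ofReal_mul (by positivity), ENNReal.ofReal_mul (by positivity),
    ← ENNReal.ofReal_rpow_of_nonneg (by positivity) hs0.le, ENNReal.ofReal_coe_nnreal,
    ENNReal.ofReal_pow (by positivity), ENNReal.ofReal_natCast, ENNReal.ofReal_natCast]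

variable {d : ℕ} {A : Type*} [Fintype A] [Nonempty A]

theorem ae_codingMap_mem_intrinsicWellApprox [MeasurableSpace A] [DiscreteMeasurableSpace A]
    {q : ℤ} (hq : 2 ≤ |q|) (p : A → Fin d → ℤ) {Ψ : ℕ → ℝ≥0} (hΨ : AntitoneOn Ψ (Set.Ici 1))
    (hp : ∃ a b, p a ≠ p b)
    (hsum : ∑' n : ℕ, (n : ℝ≥0∞) * (Fintype.card A : ℝ≥0∞) ^ n *
      (Ψ (q.natAbs ^ n) : ℝ≥0∞) ^ (Real.log (Fintype.card A) / Real.log (q.natAbs : ℝ)) = ∞) :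
    ∀ᵐ ω ∂uniformProduct A, codingMap q p ω ∈ intrinsicWellApprox q p Ψ := by
  have hA : 2 ≤ Fintype.card A := by
    obtain ⟨a, b, hab⟩ := hp
    exact Fintype.one_lt_card_iff.2 ⟨a, b, fun h => hab (h ▸ rfl)⟩
  have hQ := two_le_natAbs hq
  obtain ⟨D, hD, hdist⟩ := exists_norm_codingMap_sub_le hq p
  obtain ⟨t, ht, hdiv⟩ := exists_time_of_tsum_eq_top hA hQ hD (fun n => Ψ (q.natAbs ^ n)) hsum
  filter_upwards [ae_infinite_recurrence hA t _ hdiv, ae_not_isRationalPoint hq p hp]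
    with ω hω hirr
  refine ⟨⟨ω, rfl⟩, fun hfin => ?_⟩
  -- A point outside `ℚ^d` stays away from finitely many rational points.
  obtain ⟨ε, hε, hball⟩ := Metric.isOpen_iff.1 hfin.isClosed.isOpen_compl (codingMap q p ω)
    fun h => hirr h.2.1
  have hlim : Tendsto (fun n : ℕ => D * (q.natAbs : ℝ)⁻¹ ^ n) atTop (𝓝 0) := by
    have h1 : (1 : ℝ) < q.natAbs := by exact_mod_cast hQ
    simpa using (tendsto_pow_atTop_nhds_zero_of_lt_one (r := (q.natAbs : ℝ)⁻¹) (by positivity)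
      (inv_lt_one_of_one_lt₀ h1)).const_mul D
  obtain ⟨N, hN⟩ := eventually_atTop.1 (hlim.eventually_lt_const hε)
  obtain ⟨n, ⟨hn, l, hl, hrec⟩, hNn⟩ := hω.exists_gt N
  set y := codingMap q p (eventuallyPeriodic (fun i : Fin n => ω i) ⟨l, hl⟩) with hy
  have hclose : ‖codingMap q p ω - y‖ ≤ D * (q.natAbs : ℝ)⁻¹ ^ (n + t n) :=
    hdist _ _ _ fun i hi =>
      (eventuallyPeriodic_eq_of_mem_recurrenceEvent (⟨l, hl⟩ : Fin n) hrec hi).symm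
  have hyX : y ∈ selfSimilarSet q p := ⟨_, rfl⟩
  have hyr : IsRationalPoint y := isRationalPoint_codingMap_eventuallyPeriodic hq p _ _
  have hden : intrinsicDenom q p y ≤ q.natAbs ^ (n + 1) := by
    refine le_trans ?_ (natAbs_denom_le hq hl)
    unfold intrinsicDenom
    exact Nat.sInf_le ⟨n, _, ⟨l, hl⟩, hy, rfl⟩
  have hden1 : 1 ≤ intrinsicDenom q p y := by
    obtain ⟨m, a, k, -, h⟩ := exists_intrinsicDenom_eq hq p hyX hyr
    rw [h]
    exact (Nat.one_le_pow _ _ (by omega)).trans (pow_le_natAbs_denom hq k.isLt)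
  have hΨy : Ψ (q.natAbs ^ (n + 1)) ≤ Ψ (intrinsicDenom q p y) :=
    hΨ (Set.mem_Ici.2 hden1) (Set.mem_Ici.2 (hden1.trans hden)) hden
  have hyball : y ∈ Metric.ball (codingMap q p ω) ε := by
    rw [Metric.mem_ball, dist_comm, dist_eq_norm]
    refine hclose.trans_lt (lt_of_le_of_lt ?_ (hN n hNn.le))
    refine mul_le_mul_of_nonneg_left (pow_le_pow_of_le_one (by positivity) ?_ (by omega)) hD.le
    exact inv_le_one_of_one_le₀ (by exact_mod_cast (by omega : 1 ≤ q.natAbs))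
  exact hball hyball ⟨hyX, hyr, (hclose.trans_lt (ht n hn)).trans_le (by exact_mod_cast hΨy)⟩

theorem selfSimilarMeasure_intrinsicWellApprox_eq_one
    {q : ℤ} (hq : 2 ≤ |q|) (p : A → Fin d → ℤ) {Ψ : ℕ → ℝ≥0} (hΨ : AntitoneOn Ψ (Set.Ici 1))
    (hp : ∃ a b, p a ≠ p b)
    (hsum : ∑' n : ℕ, (n : ℝ≥0∞) * (Fintype.card A : ℝ≥0∞) ^ n *
      (Ψ (q.natAbs ^ n) : ℝ≥0∞) ^ (Real.log (Fintype.card A) / Real.log (q.natAbs : ℝ)) = ∞) :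
    selfSimilarMeasure q p (intrinsicWellApprox q p Ψ) = 1 := by
  let : MeasurableSpace A := ⊤
  have := isProbabilityMeasure_selfSimilarMeasure hq p
  refine le_antisymm prob_le_one ?_
  have hae := ae_codingMap_mem_intrinsicWellApprox hq p hΨ hp hsum
  have h1 : uniformProduct A (codingMap q p ⁻¹' intrinsicWellApprox q p Ψ) = 1 := by
    rw [← measure_univ (μ := uniformProduct A)]
    exact measure_congr (eventuallyEq_univ.2 hae)
  rw [← h1]
  -- `Measure.le_map_apply` holds for arbitrary sets, so the measurability of `W*` is not needed.
  exact Measure.le_map_apply (measurable_codingMap hq p).aemeasurable _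

end Divergence

end IntrinsicApprox

theorem theorem2p3 {d : ℕ} {A : Type*} [Fintype A] [Nonempty A]
    (q : ℤ) (hq : 2 ≤ |q|) (p : A → Fin d → ℤ)
    (Ψ : ℕ → ℝ≥0) (hΨ : AntitoneOn Ψ (Set.Ici 1)) :
    (∀ s : ℝ, 0 ≤ s →
      ∑' n : ℕ, (n : ℝ≥0∞) * (Fintype.card A : ℝ≥0∞) ^ n * (Ψ (q.natAbs ^ n) : ℝ≥0∞) ^ s < ∞ →
      Measure.hausdorffMeasure s (IntrinsicApprox.intrinsicWellApprox q p Ψ) = 0) ∧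
    ((∃ a b, p a ≠ p b) →
      ∑' n : ℕ, (n : ℝ≥0∞) * (Fintype.card A : ℝ≥0∞) ^ n *
        (Ψ (q.natAbs ^ n) : ℝ≥0∞) ^ (Real.log (Fintype.card A) / Real.log (q.natAbs : ℝ)) = ∞ →
      IntrinsicApprox.selfSimilarMeasure q p (IntrinsicApprox.intrinsicWellApprox q p Ψ) = 1) :=
  ⟨fun _ hs hsum => IntrinsicApprox.hausdorffMeasure_intrinsicWellApprox_eq_zero hq p hΨ hs hsum,
    fun hp hsum =>
      IntrinsicApprox.selfSimilarMeasure_intrinsicWellApprox_eq_one hq p hΨ hp hsum⟩
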